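/- **Theorem.** Let $D=d/dz$. For $b>0$ let $\mathcal B_b$ be the space of entire functions $f:\mathbb C\to\mathbb C$ with $\|f\|_b=\sup_{k\ge 0} b^{-k}|f^{(k)}(0)|<\infty$. For $a\ge 0$ let $\mathcal A_a=\bigcap_{b>a}\mathcal B_b$, with the topology given by the norms $\|\cdot\|_b$, $b>a$. Let $\mathcal L^+$ be the set of Laguerre entire functions $$f(z)=Cz^m e^{\alpha z}\prod_{j=1}^\infty(1+\beta_j z),\qquad C\in\mathbb C,\ m\in\mathbb N_0,\ \alpha\ge 0,\ \beta_j\ge\beta_{j+1}\ge 0,\ \sum_j\beta_j<\infty,$$ and let $\mathcal L^+_a=\mathcal L^+\cap\mathcal A_a$ carry the topology induced from $\mathcal A_a$. For $\theta\ge 0$, $\omega\in\mathbb R$ put $$\Delta_{\theta,\omega}=(\theta+zD)D+\omega zD .$$ Let $\theta\ge 0$, $\omega\in\mathbb R$ (possibly negative), $a\ge 0$, $b\ge 0$ satisfy $b\,\omega^{-1}(e^{a\omega}-1)<1$, and let $$c=c(b)=b\,e^{a\omega}\bigl(1-b\,\omega^{-1}(e^{a\omega}-1)\bigr)^{-1},$$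 where $\omega^{-1}(e^{a\omega}-1)$ means $a$ if $\omega=0$. Then: 1. There is exactly one continuous linear operator $\exp(a\Delta_{\theta,\omega}):\mathcal A_b\to\mathcal A_c$ that is given on every polynomial $f$ by the series $$\bigl(\exp(a\Delta_{\theta,\omega})f\bigr)(z)=\sum_{k=0}^\infty\frac{a^k}{k!}\bigl(\Delta_{\theta,\omega}^k f\bigr)(z),\qquad z\in\mathbb C .$$ If moreover $b\,|\omega|^{-1}(e^{a|\omega|}-1)<1$ (which is automatic for $\omega\ge 0$), then this series converges to $\exp(a\Delta_{\theta,\omega})f$ at every $z\in\mathbb C$ for every $f\in\mathcal A_b$. 2. $\exp(a\Delta_{\theta,\omega})$ maps $\mathcal L^+_b$ into $\mathcal L^+_c$, and is continuous as a map from $\mathcal L^+_b$ into $\mathcal L^+_c$. -/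

import Mathlib

noncomputable section

namespace LaguerreOp

/-- `‖f‖_b = sup_k b^{-k} |f^{(k)}(0)|`; meaningful for `f` in `MemB b`. -/
def bNorm (b : ℝ) (f : ℂ → ℂ) : ℝ :=
  ⨆ k : ℕ, (b ^ k)⁻¹ * ‖iteratedDeriv k f 0‖

/-- Membership in `𝓑_b`: entire functions with `‖f‖_b < ∞`. -/
def MemB (b : ℝ) (f : ℂ → ℂ) : Prop :=
  Differentiable ℂ f ∧
    BddAbove (Set.range fun k : ℕ => (b ^ k)⁻¹ * ‖iteratedDeriv k f 0‖)

theorem iteratedDeriv_add_zero {f g : ℂ → ℂ} (hf : Differentiable ℂ f)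
    (hg : Differentiable ℂ g) (k : ℕ) :
    iteratedDeriv k (f + g) 0 = iteratedDeriv k f 0 + iteratedDeriv k g 0 :=
  iteratedDeriv_add hf.contDiff.contDiffAt hg.contDiff.contDiffAt

theorem iteratedDeriv_smul_zero {f : ℂ → ℂ} (r : ℂ) (hf : Differentiable ℂ f) (k : ℕ) :
    iteratedDeriv k (r • f) 0 = r * iteratedDeriv k f 0 := by
  rw [iteratedDeriv_const_smul hf.contDiff.contDiffAt r, smul_eq_mul]

theorem term_add_le {b : ℝ} (hb : 0 < b) {f g : ℂ → ℂ} (hf : MemB b f) (hg : MemB b g)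
    (k : ℕ) : (b ^ k)⁻¹ * ‖iteratedDeriv k (f + g) 0‖ ≤ bNorm b f + bNorm b g := by
  rw [iteratedDeriv_add_zero hf.1 hg.1]
  calc (b ^ k)⁻¹ * ‖iteratedDeriv k f 0 + iteratedDeriv k g 0‖
      ≤ (b ^ k)⁻¹ * (‖iteratedDeriv k f 0‖ + ‖iteratedDeriv k g 0‖) := by
        gcongr; exact norm_add_le _ _
    _ = (b ^ k)⁻¹ * ‖iteratedDeriv k f 0‖ + (b ^ k)⁻¹ * ‖iteratedDeriv k g 0‖ := by ring
    _ ≤ bNorm b f + bNorm b g := add_le_add (le_ciSup hf.2 k) (le_ciSup hg.2 k)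

theorem term_smul {b : ℝ} (r : ℂ) {f : ℂ → ℂ} (hf : MemB b f) (k : ℕ) :
    (b ^ k)⁻¹ * ‖iteratedDeriv k (r • f) 0‖ = ‖r‖ * ((b ^ k)⁻¹ * ‖iteratedDeriv k f 0‖) := by
  rw [iteratedDeriv_smul_zero r hf.1, norm_mul]; ring

theorem MemB.add {b : ℝ} (hb : 0 < b) {f g : ℂ → ℂ} (hf : MemB b f) (hg : MemB b g) :
    MemB b (f + g) :=
  ⟨hf.1.add hg.1, ⟨bNorm b f + bNorm b g, by
    rintro _ ⟨k, rfl⟩; exact term_add_le hb hf hg k⟩⟩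

theorem MemB.smul {b : ℝ} (r : ℂ) {f : ℂ → ℂ} (hf : MemB b f) : MemB b (r • f) :=
  ⟨hf.1.const_smul r, ⟨‖r‖ * bNorm b f, by
    rintro _ ⟨k, rfl⟩
    simp only [term_smul r hf k]
    exact mul_le_mul_of_nonneg_left (le_ciSup hf.2 k) (norm_nonneg r)⟩⟩

/-- The index set of the norms `‖·‖_b`, `b > a`, on `𝓐_a`; for `a ≥ 0`, the only case of
interest, the condition `0 < b` is automatic. -/
abbrev Idx (a : ℝ) : Type := {b : ℝ // 0 < b ∧ a < b}

/-- `𝓐_a = ⋂_{b > a} 𝓑_b` as a vector space of functions. -/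
def ASub (a : ℝ) : Submodule ℂ (ℂ → ℂ) where
  carrier := {f | ∀ b : Idx a, MemB (b : ℝ) f}
  add_mem' hf hg b := (hf b).add b.2.1 (hg b)
  zero_mem' b := ⟨differentiable_const 0, ⟨0, by
    rintro _ ⟨k, rfl⟩
    have h : iteratedDeriv k (0 : ℂ → ℂ) 0 = 0 := by
      have := iteratedDeriv_smul_zero (f := (0 : ℂ → ℂ)) 0 (differentiable_const 0) k
      simpa only [zero_smul, zero_mul] using this
    simp [h]⟩⟩
  smul_mem' r _ hf b := (hf b).smul r

/-- The space `𝓐_a`. It is a separate type so that it does not carry the topology of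
pointwise convergence of `ℂ → ℂ`. -/
def A (a : ℝ) : Type := ↥(ASub a)

instance (a : ℝ) : AddCommGroup (A a) := inferInstanceAs (AddCommGroup ↥(ASub a))

instance (a : ℝ) : Module ℂ (A a) := inferInstanceAs (Module ℂ ↥(ASub a))

instance (a : ℝ) : CoeFun (A a) (fun _ => ℂ → ℂ) := ⟨fun f => f.1⟩

/-- The norms `‖·‖_b`, `b > a`, on `𝓐_a`. -/
def normFamily (a : ℝ) : SeminormFamily ℂ (A a) (Idx a) := fun b =>
  Seminorm.of (fun f => bNorm (b : ℝ) f)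
    (fun f g => ciSup_le fun k => term_add_le b.2.1 (f.2 b) (g.2 b) k)
    (fun r f => by
      change (⨆ k : ℕ, ((b : ℝ) ^ k)⁻¹ * ‖iteratedDeriv k (r • f.1) 0‖) = _
      simp only [term_smul r (f.2 b)]
      exact (Real.mul_iSup_of_nonneg (norm_nonneg r) _).symm)

instance (a : ℝ) : Nonempty (Idx a) :=
  ⟨⟨max a 0 + 1, by positivity, by linarith [le_max_left a 0]⟩⟩

/-- The topology `𝓣_a` defined by the norms `‖·‖_b`, `b > a`. -/
instance (a : ℝ) : TopologicalSpace (A a) := (normFamily a).moduleFilterBasis.topology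

/-- The Laguerre entire functions `𝓛⁺`. -/
def IsLaguerre (f : ℂ → ℂ) : Prop :=
  ∃ (C : ℂ) (m : ℕ) (α : ℝ) (β : ℕ → ℝ), 0 ≤ α ∧ (∀ j, 0 ≤ β j) ∧ Antitone β ∧
    Summable β ∧
    ∀ z, f z = C * z ^ m * Complex.exp (α * z) * ∏' j, (1 + (β j : ℂ) * z)

/-- `𝓛⁺_a = 𝓛⁺ ∩ 𝓐_a`; as a subtype of `𝓐_a` it carries the topology induced by `𝓣_a`. -/
def Lplus (a : ℝ) : Set (A a) := {f | IsLaguerre f}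

/-- `Δ_{θ,ω} = (θ + zD)D + ωzD`. -/
def Delta (θ ω : ℝ) (f : ℂ → ℂ) : ℂ → ℂ := fun z =>
  (θ : ℂ) * deriv f z + z * deriv (deriv f) z + (ω : ℂ) * z * deriv f z

/-- The series `∑_{k ≥ 0} φ^{(k)}(0) / k! · (Δ_{θ,ω}^k f)(z)` converges to `g z` for every `z`. -/
def HasSeries (φ : ℂ → ℂ) (θ ω : ℝ) (f g : ℂ → ℂ) : Prop :=
  ∀ z, HasSum (fun k : ℕ => iteratedDeriv k φ 0 / (k.factorial : ℂ) * ((Delta θ ω)^[k] f) z) (g z)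

/-- `ω⁻¹(e^{aω} - 1)`, read as its limit `a` when `ω = 0`. -/
def gam (a ω : ℝ) : ℝ := if ω = 0 then a else ω⁻¹ * (Real.exp (a * ω) - 1)

/-- `c(b) = b e^{aω} (1 - b ω⁻¹[e^{aω} - 1])⁻¹`. -/
def cOf (a ω b : ℝ) : ℝ := b * Real.exp (a * ω) * (1 - b * gam a ω)⁻¹

/-- `E` is the operator `exp(aΔ_{θ,ω})` on `𝓐_b`: the continuous linear operator that is
given on polynomials by the power series of `exp(a ·)` in `Δ_{θ,ω}`. -/
def IsExpDelta (a θ ω : ℝ) {b c : ℝ} (E : A b →L[ℂ] A c) : Prop :=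
  ∀ (f : A b) (p : Polynomial ℂ), (∀ z, f z = p.eval z) →
    HasSeries (fun z => Complex.exp (a * z)) θ ω f (E f)

end LaguerreOp

end

open Filter Topology Finset
open scoped Nat

noncomputable section

/-! An entire function is encoded by its derivatives `u k` at `0`, so membership in the spaces and
continuity become geometric bounds `‖u k‖ ≤ B * r ^ k`. Put γ = ω⁻¹(e^{aω} - 1). Then exp(aΔ_{θ,ω})
is exp(γ(θ + zD)D) followed by the dilation z ↦ e^{aω}z, and the first factor sends `u` to Σ_j
(θ+k)_j/j! · γ^j u_{k+j}. The binomial series sums the majorant: rate r becomes r/(1 - rγ), and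
after dilation exactly c(r). Continuity of c at b then gives a continuous operator from 𝓐_b to 𝓐_c.

The matrix entries of this operator are entire in a and satisfy the linear recursion in d/da that
defines the powers of Δ_{θ,ω}; hence their Taylor coefficients at a = 0 are the entries of those
powers, up to factorials. Replacing ω by |ω| gives a nonnegative majorant, which justifies
rearranging the triple series (`hasSeries_egf_expDeltaSeq`). Density of polynomials and the
Hausdorff property give uniqueness.

For the Laguerre class, write E = exp(γ(θ + zD)D). Conjugation gives E z = (z + γ(θ + 2zD) + γ²(θ +
zD)D) E, so adjoining a root -x ≤ 0 to p changes g = Ep into an explicit second-order expression in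
g. At z = w² with Re w > 0 this expression, divided by g, becomes an element of the right half-plane
after multiplication by a suitable conjugate, so it has no zero off (-∞, 0]
(`NonposRooted.stepPoly`). Induction on the roots shows that E preserves polynomials with only
nonpositive roots.

A general Laguerre function is a limit of such polynomials with a uniform exponential bound, and E
commutes with this limit. A compactness argument (`isLaguerre_of_tendsto`) identifies limits that do
not vanish at 0; the mass lost by the β_j goes into the exponential factor. The image vanishes at 0
only if f = 0, or if θ = 0 and f(0) = 0; the latter reduces to θ = 2 through zD² z = z(2 + zD)D. -/

namespace LaguerreOp

/-! ### Rising factorials and the binomial series -/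

/-- The coefficient `(s)_j / j!` of `x ^ j` in `(1 - x) ^ (-s)`. -/
def risingCoeff (s : ℝ) (j : ℕ) : ℝ := (∏ i ∈ range j, (s + i)) / (j ! : ℝ)

@[simp] theorem risingCoeff_zero (s : ℝ) : risingCoeff s 0 = 1 := by simp [risingCoeff]

theorem risingCoeff_succ (s : ℝ) (j : ℕ) :
    risingCoeff s (j + 1) * (j + 1) = risingCoeff s j * (s + j) := by
  have h : (j ! : ℝ) ≠ 0 := by positivity
  rw [risingCoeff, risingCoeff, prod_range_succ, Nat.factorial_succ]
  push_cast
  field_simp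

theorem risingCoeff_succ_left (s : ℝ) (j : ℕ) :
    risingCoeff s (j + 1) * (j + 1) = s * risingCoeff (s + 1) j := by
  have h : (j ! : ℝ) ≠ 0 := by positivity
  have h2 : ∏ i ∈ range j, (s + ((i + 1 : ℕ) : ℝ)) = ∏ i ∈ range j, (s + 1 + i) :=
    prod_congr rfl fun i _ => by push_cast; ring
  rw [risingCoeff, risingCoeff, prod_range_succ', Nat.factorial_succ, h2]
  push_cast
  field_simp
  ring

theorem risingCoeff_nonneg {s : ℝ} (hs : 0 ≤ s) (j : ℕ) : 0 ≤ risingCoeff s j :=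
  div_nonneg (prod_nonneg fun _ _ => by positivity) (by positivity)

theorem risingCoeff_pos {s : ℝ} (hs : 0 < s) (j : ℕ) : 0 < risingCoeff s j :=
  div_pos (prod_pos fun _ _ => by positivity) (by positivity)

/-- Makes the binomial series of (1 - x)^{-s}, whose coefficients are `Ring.choose`, available. -/
theorem risingCoeff_eq_choose (s : ℝ) (j : ℕ) :
    risingCoeff s j = Ring.choose (s + j - 1) j := by
  rw [← Ring.multichoose_eq, eq_comm, risingCoeff, eq_div_iff (by positivity), mul_comm,
    ← nsmul_eq_mul, Ring.factorial_nsmul_multichoose_eq_ascPochhammer,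
    Polynomial.ascPochhammer_smeval_eq_eval]
  induction j with
  | zero => simp
  | succ j ih => rw [ascPochhammer_succ_eval, ih, prod_range_succ]

theorem hasSum_risingCoeff (s : ℝ) {x : ℝ} (hx0 : 0 ≤ x) (hx : x < 1) :
    HasSum (fun j => risingCoeff s j * x ^ j) ((1 - x) ^ (-s)) := by
  have h := (Real.one_div_one_sub_rpow_hasFPowerSeriesOnBall_zero s).hasSum (y := x) (by
    simp [abs_of_nonneg hx0, enorm_eq_nnnorm, ← NNReal.coe_lt_coe, hx])
  simp only [zero_add, one_div, ← Real.rpow_neg (by linarith : 0 ≤ 1 - x)] at h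
  refine h.congr_fun fun j => ?_
  simp [risingCoeff_eq_choose, mul_comm]

/-! ### Entire functions from their derivatives at 0 -/

/-- The exponential generating function of `u`, the function with derivatives `u` at `0`. -/
def egf (u : ℕ → ℂ) (z : ℂ) : ℂ := ∑' k, u k / (k ! : ℂ) * z ^ k

theorem norm_egf_term_le {u : ℕ → ℂ} {B r : ℝ} (hu : ∀ k, ‖u k‖ ≤ B * r ^ k) {z : ℂ} {R : ℝ}
    (hz : ‖z‖ ≤ R) (k : ℕ) : ‖u k / (k ! : ℂ) * z ^ k‖ ≤ B * ((r * R) ^ k / (k ! : ℝ)) := by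
  have h0 : 0 ≤ B * r ^ k := (norm_nonneg _).trans (hu k)
  rw [norm_mul, norm_div, norm_pow, Complex.norm_natCast, mul_pow]
  calc ‖u k‖ / (k ! : ℝ) * ‖z‖ ^ k ≤ (B * r ^ k) / (k ! : ℝ) * R ^ k := by
        gcongr
        exact hu k
    _ = _ := by ring

theorem summable_egf_bound (B r R : ℝ) :
    Summable fun k : ℕ => B * ((r * R) ^ k / (k ! : ℝ)) :=
  (Real.summable_pow_div_factorial _).mul_left _

theorem summable_egf {u : ℕ → ℂ} {B r : ℝ} (hu : ∀ k, ‖u k‖ ≤ B * r ^ k) (z : ℂ) :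
    Summable fun k => u k / (k ! : ℂ) * z ^ k :=
  .of_norm_bounded (summable_egf_bound B r ‖z‖) (norm_egf_term_le hu le_rfl)

theorem norm_egf_le {u : ℕ → ℂ} {B r : ℝ} (hu : ∀ k, ‖u k‖ ≤ B * r ^ k) (z : ℂ) :
    ‖egf u z‖ ≤ B * Real.exp (r * ‖z‖) := by
  refine tsum_of_norm_bounded ?_ (norm_egf_term_le hu le_rfl)
  refine HasSum.mul_left _ ?_
  rw [Real.exp_eq_exp_ℝ]
  exact NormedSpace.expSeries_div_hasSum_exp _

@[simp] theorem egf_zero (u : ℕ → ℂ) : egf u 0 = u 0 := by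
  rw [egf, tsum_eq_single 0 fun k hk => by simp [hk]]
  simp

theorem norm_shift_le {u : ℕ → ℂ} {B r : ℝ} (hu : ∀ k, ‖u k‖ ≤ B * r ^ k) (k : ℕ) :
    ‖u (k + 1)‖ ≤ B * r * r ^ k := (hu (k + 1)).trans_eq (by ring)

theorem hasDerivAt_egf {u : ℕ → ℂ} {B r : ℝ} (hu : ∀ k, ‖u k‖ ≤ B * r ^ k) (z : ℂ) :
    HasDerivAt (egf u) (egf (fun k => u (k + 1)) z) z := by
  have hz : z ∈ Metric.ball (0 : ℂ) (‖z‖ + 1) := by simp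
  have hd : ∀ k : ℕ, Differentiable ℂ fun w : ℂ => u k / (k ! : ℂ) * w ^ k := fun k => by fun_prop
  have hb : ∀ (k : ℕ) (w : ℂ), w ∈ Metric.ball (0 : ℂ) (‖z‖ + 1) →
      ‖u k / (k ! : ℂ) * w ^ k‖ ≤ B * ((r * (‖z‖ + 1)) ^ k / (k ! : ℝ)) := fun k w hw =>
    norm_egf_term_le hu (le_of_lt (by simpa using hw)) k
  have h1 := Complex.hasSum_deriv_of_summable_norm (summable_egf_bound B r (‖z‖ + 1))
    (fun k => (hd k).differentiableOn) Metric.isOpen_ball hb hz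
  have h2 := (Complex.differentiableOn_tsum_of_summable_norm (summable_egf_bound B r (‖z‖ + 1))
    (fun k => (hd k).differentiableOn) Metric.isOpen_ball hb).differentiableAt
    (Metric.isOpen_ball.mem_nhds hz)
  have h3 : deriv (egf u) z = egf (fun k => u (k + 1)) z := by
    refine h1.unique ?_
    rw [← hasSum_nat_add_iff' 1]
    simp only [range_one, sum_singleton, pow_zero, mul_one, deriv_const, sub_zero]
    refine (summable_egf (norm_shift_le hu) z).hasSum.congr_fun fun k => ?_
    have h : (k ! : ℂ) ≠ 0 := by exact_mod_cast k.factorial_ne_zero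
    have h' : (k : ℂ) + 1 ≠ 0 := by exact_mod_cast k.succ_ne_zero
    simp only [deriv_const_mul_field', differentiableAt_fun_id, deriv_fun_pow, Nat.factorial_succ]
    push_cast
    field_simp
    simp
  rw [← h3]
  exact h2.hasDerivAt

theorem differentiable_egf {u : ℕ → ℂ} {B r : ℝ} (hu : ∀ k, ‖u k‖ ≤ B * r ^ k) :
    Differentiable ℂ (egf u) := fun z => (hasDerivAt_egf hu z).differentiableAt

theorem deriv_egf {u : ℕ → ℂ} {B r : ℝ} (hu : ∀ k, ‖u k‖ ≤ B * r ^ k) :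
    deriv (egf u) = egf fun k => u (k + 1) := funext fun z => (hasDerivAt_egf hu z).deriv

theorem iteratedDeriv_egf {u : ℕ → ℂ} {B r : ℝ} (hu : ∀ k, ‖u k‖ ≤ B * r ^ k) (n : ℕ) :
    iteratedDeriv n (egf u) 0 = u n := by
  induction n generalizing u B with
  | zero => simp
  | succ n ih => rw [iteratedDeriv_succ', deriv_egf hu, ih (norm_shift_le hu)]

theorem egf_iteratedDeriv {f : ℂ → ℂ} (hf : Differentiable ℂ f) :
    egf (fun k => iteratedDeriv k f 0) = f := by
  ext z
  rw [← Complex.taylorSeries_eq_of_entire' 0 z hf, egf]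
  refine tsum_congr fun k => ?_
  rw [sub_zero]
  ring

/-! ### The operator exp(γ(θ + zD)D) on derivative sequences -/

/-- The action of `exp (γ (θ + zD) D)` on the sequence of derivatives at `0`. -/
def expSeq (θ γ : ℝ) (u : ℕ → ℂ) (k : ℕ) : ℂ :=
  ∑' j, ((risingCoeff (θ + k) j * γ ^ j : ℝ) : ℂ) * u (k + j)

theorem norm_expSeq_term_le {θ γ : ℝ} (hθ : 0 ≤ θ) (hγ : 0 ≤ γ) {u : ℕ → ℂ} {B r : ℝ}
    (hu : ∀ k, ‖u k‖ ≤ B * r ^ k) (k j : ℕ) :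
    ‖((risingCoeff (θ + k) j * γ ^ j : ℝ) : ℂ) * u (k + j)‖ ≤
      B * r ^ k * (risingCoeff (θ + k) j * (r * γ) ^ j) := by
  have h := risingCoeff_nonneg (by positivity : 0 ≤ θ + k) j
  rw [norm_mul, Complex.norm_real, Real.norm_of_nonneg (by positivity)]
  calc risingCoeff (θ + k) j * γ ^ j * ‖u (k + j)‖
      ≤ risingCoeff (θ + k) j * γ ^ j * (B * r ^ (k + j)) := by gcongr; exact hu _
    _ = _ := by rw [mul_pow, pow_add]; ring

/-- Binomial series with exponent -(θ + k): the part (1 - rγ)^{-k} merges with r^k into the new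
growth rate, while (1 - rγ)^{-θ} is a constant independent of k. -/
theorem hasSum_expSeq_bound {θ γ : ℝ} (hγ : 0 ≤ γ) {B r : ℝ} (hr : 0 ≤ r)
    (hrγ : r * γ < 1) (k : ℕ) :
    HasSum (fun j => B * r ^ k * (risingCoeff (θ + k) j * (r * γ) ^ j))
      (B * (1 - r * γ) ^ (-θ) * (r * (1 - r * γ)⁻¹) ^ k) := by
  have h1 : 0 < 1 - r * γ := by linarith
  convert! (hasSum_risingCoeff (θ + k) (by positivity : 0 ≤ r * γ) hrγ).mul_left (B * r ^ k) using 1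
  rw [neg_add, Real.rpow_add h1, Real.rpow_neg_natCast, zpow_neg, zpow_natCast, mul_pow, inv_pow]
  ring

theorem summable_expSeq {θ γ : ℝ} (hθ : 0 ≤ θ) (hγ : 0 ≤ γ) {u : ℕ → ℂ} {B r : ℝ}
    (hr : 0 ≤ r) (hrγ : r * γ < 1) (hu : ∀ k, ‖u k‖ ≤ B * r ^ k) (k : ℕ) :
    Summable fun j => ((risingCoeff (θ + k) j * γ ^ j : ℝ) : ℂ) * u (k + j) :=
  .of_norm_bounded (hasSum_expSeq_bound hγ hr hrγ k).summable (norm_expSeq_term_le hθ hγ hu k)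

theorem norm_expSeq_le {θ γ : ℝ} (hθ : 0 ≤ θ) (hγ : 0 ≤ γ) {u : ℕ → ℂ} {B r : ℝ}
    (hr : 0 ≤ r) (hrγ : r * γ < 1) (hu : ∀ k, ‖u k‖ ≤ B * r ^ k) (k : ℕ) :
    ‖expSeq θ γ u k‖ ≤ B * (1 - r * γ) ^ (-θ) * (r * (1 - r * γ)⁻¹) ^ k :=
  tsum_of_norm_bounded (hasSum_expSeq_bound hγ hr hrγ k) (norm_expSeq_term_le hθ hγ hu k)

/-! ### The parameters γ and c, and the norms of 𝓐_b -/

theorem gam_nonneg {a : ℝ} (ha : 0 ≤ a) (ω : ℝ) : 0 ≤ gam a ω := by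
  unfold gam
  split_ifs with h
  · exact ha
  · rcases lt_or_gt_of_ne h with h | h
    · refine mul_nonneg_of_nonpos_of_nonpos (inv_nonpos.2 h.le) ?_
      have : Real.exp (a * ω) ≤ 1 := Real.exp_le_one_iff.2 (by nlinarith)
      linarith
    · refine mul_nonneg (inv_nonneg.2 h.le) ?_
      have : 1 ≤ Real.exp (a * ω) := Real.one_le_exp (by positivity)
      linarith

theorem cOf_nonneg {a ω b : ℝ} (hb : 0 ≤ b) (hab : b * gam a ω < 1) : 0 ≤ cOf a ω b :=
  mul_nonneg (by positivity) (inv_nonneg.2 (by linarith))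

/-- Continuity of c(·) at b. Each norm of the target, with index c > c(b), is thereby controlled by
a norm of the source, with index r > b. -/
theorem exists_cOf_lt {a ω b c : ℝ} (hab : b * gam a ω < 1)
    (hc : cOf a ω b < c) : ∃ r, b < r ∧ r * gam a ω < 1 ∧ cOf a ω r < c := by
  have h1 : ContinuousAt (fun r => r * gam a ω) b := by fun_prop
  have h2 : ContinuousAt (cOf a ω) b := by
    unfold cOf
    refine ContinuousAt.mul (by fun_prop) (ContinuousAt.inv₀ (by fun_prop) (by linarith))
  have h3 := (h1.eventually_lt_const hab).and (h2.eventually_lt_const hc)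
  obtain ⟨r, hr, hr'⟩ := ((h3.filter_mono nhdsWithin_le_nhds).and
    (self_mem_nhdsWithin (s := Set.Ioi b))).exists
  exact ⟨r, hr', hr.1, hr.2⟩

theorem withSeminorms_normFamily (a : ℝ) : WithSeminorms (normFamily a) := ⟨rfl⟩

theorem normFamily_apply {a : ℝ} (r : Idx a) (f : A a) : normFamily a r f = bNorm r f := rfl

theorem norm_iteratedDeriv_le_bNorm {r : ℝ} (hr : 0 < r) {f : ℂ → ℂ} (hf : MemB r f) (k : ℕ) :
    ‖iteratedDeriv k f 0‖ ≤ bNorm r f * r ^ k := by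
  have h := le_ciSup hf.2 k
  rw [inv_mul_le_iff₀ (by positivity)] at h
  rw [mul_comm]
  exact h

theorem memB_of_bound {r B : ℝ} (hr : 0 < r) {f : ℂ → ℂ} (hf : Differentiable ℂ f)
    (h : ∀ k, ‖iteratedDeriv k f 0‖ ≤ B * r ^ k) : MemB r f := by
  refine ⟨hf, B, ?_⟩
  rintro _ ⟨k, rfl⟩
  change (r ^ k)⁻¹ * _ ≤ B
  rw [inv_mul_le_iff₀ (by positivity), mul_comm]
  exact h k

theorem bNorm_le_of_bound {r B : ℝ} (hr : 0 < r) {f : ℂ → ℂ}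
    (h : ∀ k, ‖iteratedDeriv k f 0‖ ≤ B * r ^ k) : bNorm r f ≤ B :=
  ciSup_le fun k => by
    rw [inv_mul_le_iff₀ (by positivity), mul_comm]
    exact h k

/-! ### The continuous operator from 𝓐_b to 𝓐_c -/

/-- The action of `exp (a Δ_{θ,ω})` on the sequence of derivatives at `0`. -/
def expDeltaSeq (a θ ω : ℝ) (u : ℕ → ℂ) (k : ℕ) : ℂ :=
  (Real.exp (a * ω) : ℂ) ^ k * expSeq θ (gam a ω) u k

theorem norm_expDeltaSeq_le {a θ ω : ℝ} (hθ : 0 ≤ θ) (ha : 0 ≤ a) {u : ℕ → ℂ} {B r : ℝ}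
    (hr : 0 ≤ r) (hrγ : r * gam a ω < 1) (hu : ∀ k, ‖u k‖ ≤ B * r ^ k) (k : ℕ) :
    ‖expDeltaSeq a θ ω u k‖ ≤ B * (1 - r * gam a ω) ^ (-θ) * cOf a ω r ^ k := by
  rw [expDeltaSeq, norm_mul, norm_pow, Complex.norm_real, Real.norm_of_nonneg (by positivity)]
  calc _ ≤ Real.exp (a * ω) ^ k *
        (B * (1 - r * gam a ω) ^ (-θ) * (r * (1 - r * gam a ω)⁻¹) ^ k) := by
        gcongr
        exact norm_expSeq_le hθ (gam_nonneg ha ω) hr hrγ hu k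
    _ = _ := by rw [cOf, mul_pow, mul_pow, mul_pow]; ring

theorem expSeq_add {θ γ : ℝ} (hθ : 0 ≤ θ) (hγ : 0 ≤ γ) {u v : ℕ → ℂ} {B B' r : ℝ} (hr : 0 ≤ r)
    (hrγ : r * γ < 1) (hu : ∀ k, ‖u k‖ ≤ B * r ^ k) (hv : ∀ k, ‖v k‖ ≤ B' * r ^ k) (k : ℕ) :
    expSeq θ γ (fun k => u k + v k) k = expSeq θ γ u k + expSeq θ γ v k := by
  simp only [expSeq, mul_add]
  exact (summable_expSeq hθ hγ hr hrγ hu k).tsum_add (summable_expSeq hθ hγ hr hrγ hv k)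

theorem expSeq_const_mul (θ γ : ℝ) (s : ℂ) (u : ℕ → ℂ) (k : ℕ) :
    expSeq θ γ (fun k => s * u k) k = s * expSeq θ γ u k := by
  simp only [expSeq, ← tsum_mul_left, mul_left_comm]

theorem A.ext {b : ℝ} {f g : A b} (h : ∀ k, iteratedDeriv k f.1 0 = iteratedDeriv k g.1 0) :
    f = g := by
  obtain ⟨r⟩ : Nonempty (Idx b) := inferInstance
  refine Subtype.ext ?_
  rw [← egf_iteratedDeriv (f.2 r).1, ← egf_iteratedDeriv (g.2 r).1]
  simp only [h]

/-- The one estimate behind both membership of the image in 𝓐_c and continuity: `r` and `K` depend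
on the target norm but not on `f`. -/
theorem exists_expDeltaSeq_bound {θ ω a b : ℝ} (hθ : 0 ≤ θ) (ha : 0 ≤ a) (hb : 0 ≤ b)
    (hab : b * gam a ω < 1) (c : Idx (cOf a ω b)) :
    ∃ (r : Idx b) (K : ℝ), 0 ≤ K ∧ ∀ f : A b, ∀ k,
      ‖expDeltaSeq a θ ω (fun k => iteratedDeriv k f.1 0) k‖ ≤ K * bNorm r f * (c : ℝ) ^ k := by
  obtain ⟨r, hbr, hrγ, hrc⟩ := exists_cOf_lt hab c.2.2
  have hr : 0 < r := hb.trans_lt hbr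
  have h1 : 0 ≤ (1 - r * gam a ω) ^ (-θ) := Real.rpow_nonneg (by linarith) _
  refine ⟨⟨r, hr, hbr⟩, _, h1, fun f k => ?_⟩
  have hf := f.2 ⟨r, hr, hbr⟩
  refine (norm_expDeltaSeq_le hθ ha hr.le hrγ (norm_iteratedDeriv_le_bNorm hr hf) k).trans ?_
  rw [mul_comm (bNorm r f.1)]
  have h2 : 0 ≤ bNorm r f.1 := Real.iSup_nonneg fun k => by positivity
  have h3 := cOf_nonneg hr.le hrγ
  gcongr

theorem egf_expDeltaSeq_mem {θ ω a b : ℝ} (hθ : 0 ≤ θ) (ha : 0 ≤ a) (hb : 0 ≤ b)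
    (hab : b * gam a ω < 1) (f : A b) :
    egf (expDeltaSeq a θ ω fun k => iteratedDeriv k f.1 0) ∈ ASub (cOf a ω b) := by
  intro c
  obtain ⟨r, K, -, h⟩ := exists_expDeltaSeq_bound hθ ha hb hab c
  refine memB_of_bound (B := K * bNorm r f.1) c.2.1 (differentiable_egf (h f)) fun k => ?_
  rw [iteratedDeriv_egf (h f)]
  exact h f k

theorem iteratedDeriv_egf_expDeltaSeq {θ ω a b : ℝ} (hθ : 0 ≤ θ) (ha : 0 ≤ a) (hb : 0 ≤ b)
    (hab : b * gam a ω < 1) (f : A b) (k : ℕ) :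
    iteratedDeriv k (egf (expDeltaSeq a θ ω fun k => iteratedDeriv k f.1 0)) 0 =
      expDeltaSeq a θ ω (fun k => iteratedDeriv k f.1 0) k := by
  obtain ⟨c⟩ : Nonempty (Idx (cOf a ω b)) := inferInstance
  obtain ⟨r, K, -, h⟩ := exists_expDeltaSeq_bound hθ ha hb hab c
  exact iteratedDeriv_egf (h f) k

theorem expDeltaSeq_add {θ ω a b : ℝ} (hθ : 0 ≤ θ) (ha : 0 ≤ a) (hb : 0 ≤ b)
    (hab : b * gam a ω < 1) (f g : A b) (k : ℕ) :
    expDeltaSeq a θ ω (fun k => iteratedDeriv k (f + g).1 0) k =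
      expDeltaSeq a θ ω (fun k => iteratedDeriv k f.1 0) k +
        expDeltaSeq a θ ω (fun k => iteratedDeriv k g.1 0) k := by
  obtain ⟨r, hbr, hrγ, -⟩ := exists_cOf_lt hab (lt_add_one (cOf a ω b))
  have hr : 0 < r := hb.trans_lt hbr
  have hf := f.2 ⟨r, hr, hbr⟩
  have hg := g.2 ⟨r, hr, hbr⟩
  have h : (fun k => iteratedDeriv k (f + g).1 0) =
      fun k => iteratedDeriv k f.1 0 + iteratedDeriv k g.1 0 :=
    funext fun k => iteratedDeriv_add_zero hf.1 hg.1 k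
  rw [expDeltaSeq, h, expSeq_add hθ (gam_nonneg ha ω) hr.le hrγ
    (norm_iteratedDeriv_le_bNorm hr hf) (norm_iteratedDeriv_le_bNorm hr hg), mul_add]
  rfl

/-- The operator `exp (a Δ_{θ,ω})` as a linear map `𝓐_b → 𝓐_c`. -/
def expDeltaLin {θ ω a b : ℝ} (hθ : 0 ≤ θ) (ha : 0 ≤ a) (hb : 0 ≤ b)
    (hab : b * gam a ω < 1) : A b →ₗ[ℂ] A (cOf a ω b) where
  toFun f := ⟨_, egf_expDeltaSeq_mem hθ ha hb hab f⟩
  map_add' f g := by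
    obtain ⟨c⟩ : Nonempty (Idx (cOf a ω b)) := inferInstance
    refine A.ext fun k => ?_
    refine (iteratedDeriv_egf_expDeltaSeq hθ ha hb hab _ k).trans ?_
    rw [expDeltaSeq_add hθ ha hb hab f g, ← iteratedDeriv_egf_expDeltaSeq hθ ha hb hab,
      ← iteratedDeriv_egf_expDeltaSeq hθ ha hb hab]
    exact (iteratedDeriv_add_zero (egf_expDeltaSeq_mem hθ ha hb hab f c).1
      (egf_expDeltaSeq_mem hθ ha hb hab g c).1 k).symm
  map_smul' s f := by
    obtain ⟨c⟩ : Nonempty (Idx (cOf a ω b)) := inferInstance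
    obtain ⟨r⟩ : Nonempty (Idx b) := inferInstance
    refine A.ext fun k => ?_
    refine (iteratedDeriv_egf_expDeltaSeq hθ ha hb hab _ k).trans ?_
    have h : (fun k => iteratedDeriv k (s • f).1 0) = fun k => s * iteratedDeriv k f.1 0 :=
      funext fun k => iteratedDeriv_smul_zero s (f.2 r).1 k
    rw [expDeltaSeq, h, expSeq_const_mul, mul_left_comm]
    refine Eq.trans ?_
      (iteratedDeriv_smul_zero s (egf_expDeltaSeq_mem hθ ha hb hab f c).1 k).symm
    rw [iteratedDeriv_egf_expDeltaSeq hθ ha hb hab]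
    rfl

/-- The operator `exp (a Δ_{θ,ω}) : 𝓐_b → 𝓐_c`. -/
def expDelta {θ ω a b : ℝ} (hθ : 0 ≤ θ) (ha : 0 ≤ a) (hb : 0 ≤ b)
    (hab : b * gam a ω < 1) : A b →L[ℂ] A (cOf a ω b) where
  toLinearMap := expDeltaLin hθ ha hb hab
  cont := by
    refine WithSeminorms.continuous_of_isBounded (withSeminorms_normFamily b)
      (withSeminorms_normFamily _) _ fun c => ?_
    obtain ⟨r, K, hK, h⟩ := exists_expDeltaSeq_bound hθ ha hb hab c
    refine ⟨{r}, ⟨K, hK⟩, fun f => ?_⟩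
    rw [Finset.sup_singleton]
    refine bNorm_le_of_bound c.2.1 fun k => ?_
    refine (congrArg norm (iteratedDeriv_egf_expDeltaSeq hθ ha hb hab f k)).trans_le ?_
    exact h f k

theorem expDelta_apply {θ ω a b : ℝ} (hθ : 0 ≤ θ) (ha : 0 ≤ a) (hb : 0 ≤ b)
    (hab : b * gam a ω < 1) (f : A b) :
    (expDelta hθ ha hb hab f).1 = egf (expDeltaSeq a θ ω fun k => iteratedDeriv k f.1 0) := rfl

/-! ### Powers of Δ and the exponential series -/

theorem differentiable_deriv {f : ℂ → ℂ} (hf : Differentiable ℂ f) : Differentiable ℂ (deriv f) :=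
  fun _ => (hf.analyticAt _).deriv.differentiableAt

theorem hasSum_egf_iteratedDeriv {f : ℂ → ℂ} (hf : Differentiable ℂ f) (z : ℂ) :
    HasSum (fun k : ℕ => iteratedDeriv k f 0 / (k ! : ℂ) * z ^ k) (f z) := by
  refine (Complex.hasSum_taylorSeries_of_entire hf 0 z).congr_fun fun k => ?_
  simp only [sub_zero, smul_eq_mul]
  ring

theorem iteratedDeriv_succ_id_mul {g : ℂ → ℂ} (hg : Differentiable ℂ g) (m : ℕ) :
    iteratedDeriv (m + 1) (fun z => z * g z) 0 = (m + 1) * iteratedDeriv m g 0 := by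
  induction m generalizing g with
  | zero =>
    have h : HasDerivAt (fun z => z * g z) (1 * g 0 + 0 * deriv g 0) 0 :=
      (hasDerivAt_id' _).mul hg.differentiableAt.hasDerivAt
    simp [iteratedDeriv_succ', h.deriv]
  | succ m ih =>
    have hg' := differentiable_deriv hg
    have h : deriv (fun z => z * g z) = fun z => g z + z * deriv g z := funext fun z => by
      have h : HasDerivAt (fun z => z * g z) (1 * g z + z * deriv g z) z :=
        (hasDerivAt_id' _).mul hg.differentiableAt.hasDerivAt
      rw [h.deriv, one_mul]
    have h2 : Differentiable ℂ fun z => z * deriv g z := by fun_prop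
    rw [iteratedDeriv_succ', h, iteratedDeriv_fun_add hg.contDiff.contDiffAt
      h2.contDiff.contDiffAt, ih hg', ← iteratedDeriv_succ']
    push_cast
    ring

/-- The action of `Δ_{θ,ω}` on the sequence of derivatives at `0`. -/
def deltaSeq (θ ω : ℝ) (u : ℕ → ℂ) (m : ℕ) : ℂ := (θ + m) * u (m + 1) + ω * m * u m

theorem differentiable_Delta (θ ω : ℝ) {f : ℂ → ℂ} (hf : Differentiable ℂ f) :
    Differentiable ℂ (Delta θ ω f) := by
  have h1 := differentiable_deriv hf
  have h2 := differentiable_deriv h1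
  unfold Delta
  fun_prop

theorem iteratedDeriv_Delta (θ ω : ℝ) {f : ℂ → ℂ} (hf : Differentiable ℂ f) :
    (fun m => iteratedDeriv m (Delta θ ω f) 0) = deltaSeq θ ω fun m => iteratedDeriv m f 0 := by
  have h1 := differentiable_deriv hf
  have h2 := differentiable_deriv h1
  have e1 : Differentiable ℂ fun z => (θ : ℂ) * deriv f z := by fun_prop
  have e2 : Differentiable ℂ fun z => z * deriv (deriv f) z := by fun_prop
  have e4 : Differentiable ℂ fun z => (ω : ℂ) * (z * deriv f z) := by fun_prop
  have e5 : Differentiable ℂ fun z => (θ : ℂ) * deriv f z + z * deriv (deriv f) z := by fun_prop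
  have hD : Delta θ ω f = fun z => (θ * deriv f z + z * deriv (deriv f) z) +
      ω * (z * deriv f z) := funext fun z => by simp [Delta, mul_assoc]
  ext m
  rw [hD, iteratedDeriv_fun_add e5.contDiff.contDiffAt e4.contDiff.contDiffAt,
    iteratedDeriv_fun_add e1.contDiff.contDiffAt e2.contDiff.contDiffAt,
    iteratedDeriv_const_mul_field,
    iteratedDeriv_const_mul_field, deltaSeq]
  cases m with
  | zero => simp [iteratedDeriv_one]
  | succ m =>
    rw [iteratedDeriv_succ_id_mul h2, iteratedDeriv_succ_id_mul h1, ← iteratedDeriv_succ',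
      ← iteratedDeriv_succ', ← iteratedDeriv_succ', ← iteratedDeriv_succ']
    push_cast
    ring

theorem iterate_Delta (θ ω : ℝ) {f : ℂ → ℂ} (hf : Differentiable ℂ f) (K : ℕ) :
    Differentiable ℂ ((Delta θ ω)^[K] f) ∧ (fun m => iteratedDeriv m ((Delta θ ω)^[K] f) 0) =
      (deltaSeq θ ω)^[K] fun m => iteratedDeriv m f 0 := by
  induction K with
  | zero => exact ⟨hf, rfl⟩
  | succ K ih =>
    rw [Function.iterate_succ_apply', Function.iterate_succ_apply', iteratedDeriv_Delta θ ω ih.1,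
      ih.2]
    exact ⟨differentiable_Delta θ ω ih.1, rfl⟩

/-- The matrix of `Δ_{θ,ω} ^ K` on sequences of derivatives at `0`: the coefficient of
`u (m + j)` in entry `m`. -/
def deltaCoeff (θ ω : ℝ) : ℕ → ℕ → ℕ → ℝ
  | 0, _, 0 => 1
  | 0, _, _ + 1 => 0
  | K + 1, m, 0 => ω * m * deltaCoeff θ ω K m 0
  | K + 1, m, j + 1 => (θ + m) * deltaCoeff θ ω K (m + 1) j + ω * m * deltaCoeff θ ω K m (j + 1)

theorem hasSum_deltaCoeff (θ ω : ℝ) (u : ℕ → ℂ) (K m : ℕ) :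
    HasSum (fun j => (deltaCoeff θ ω K m j : ℂ) * u (m + j)) ((deltaSeq θ ω)^[K] u m) := by
  induction K generalizing m with
  | zero =>
    have h := hasSum_single (f := fun j => (deltaCoeff θ ω 0 m j : ℂ) * u (m + j)) 0 fun j hj => by
      obtain ⟨j, rfl⟩ := Nat.exists_eq_succ_of_ne_zero hj
      simp [deltaCoeff]
    simpa [deltaCoeff] using h
  | succ K ih =>
    have h1 := (ih (m + 1)).mul_left ((θ : ℂ) + m)
    have h2 := ((hasSum_nat_add_iff' 1).2 (ih m)).mul_left ((ω : ℂ) * m)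
    rw [← hasSum_nat_add_iff' 1, Function.iterate_succ_apply']
    convert! h1.add h2 using 1
    · ext j
      simp only [deltaCoeff, show m + 1 + j = m + (j + 1) by ring]
      push_cast
      ring
    · simp [deltaCoeff, deltaSeq]
      ring

/-- As θ ≥ 0, ω is the only possibly negative quantity in the recursion, so |ω| gives a majorant
without cancellation. This is where the condition with |ω| on the series originates. -/
theorem abs_deltaCoeff_le {θ : ℝ} (hθ : 0 ≤ θ) (ω : ℝ) (K m j : ℕ) :
    |deltaCoeff θ ω K m j| ≤ deltaCoeff θ |ω| K m j := by
  induction K generalizing m j with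
  | zero => cases j <;> simp [deltaCoeff]
  | succ K ih =>
    have h2 : ∀ j, |ω * m * deltaCoeff θ ω K m j| ≤ |ω| * m * deltaCoeff θ |ω| K m j := fun j => by
      rw [abs_mul, abs_mul, Nat.abs_cast]
      gcongr
      exact ih _ _
    cases j with
    | zero => exact h2 0
    | succ j =>
      refine (abs_add_le _ _).trans (add_le_add ?_ (h2 _))
      rw [abs_mul, abs_of_nonneg (by positivity : 0 ≤ θ + m)]
      gcongr
      exact ih _ _

/-- The entire function of `a` extending `gam a ω`. -/
def gamC (ω : ℝ) (a : ℂ) : ℂ := if ω = 0 then a else (ω : ℂ)⁻¹ * (Complex.exp (a * ω) - 1)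

theorem gamC_ofReal (ω a : ℝ) : gamC ω a = gam a ω := by
  unfold gamC gam
  split_ifs <;> simp

theorem gamC_zero (ω : ℝ) : gamC ω 0 = 0 := by simp [gamC]

theorem hasDerivAt_gamC (ω : ℝ) (a : ℂ) : HasDerivAt (gamC ω) (Complex.exp (a * ω)) a := by
  by_cases h : ω = 0
  · have : gamC ω = fun a => a := funext fun a => by simp [gamC, h]
    rw [this]
    simpa [h] using hasDerivAt_id' a
  · have : gamC ω = fun a => (ω : ℂ)⁻¹ * (Complex.exp (a * ω) - 1) :=
      funext fun a => by simp [gamC, h]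
    rw [this]
    have h' : (ω : ℂ) ≠ 0 := by exact_mod_cast h
    convert! ((((hasDerivAt_id' a).mul_const (ω : ℂ)).cexp).sub_const 1).const_mul (ω : ℂ)⁻¹ using 1
    field_simp

/-- The matrix of `exp (a Δ_{θ,ω})` on sequences of derivatives at `0`, as a function of `a`. -/
def expCoeff (θ ω : ℝ) (m j : ℕ) (a : ℂ) : ℂ :=
  Complex.exp (a * ω) ^ m * risingCoeff (θ + m) j * gamC ω a ^ j

theorem expCoeff_ofReal (θ ω : ℝ) (m j : ℕ) (a : ℝ) : expCoeff θ ω m j a =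
    ((Real.exp (a * ω) ^ m * (risingCoeff (θ + m) j * gam a ω ^ j) : ℝ) : ℂ) := by
  rw [expCoeff, gamC_ofReal]
  push_cast
  ring

theorem hasDerivAt_expCoeff_zero (θ ω : ℝ) (m : ℕ) (a : ℂ) :
    HasDerivAt (expCoeff θ ω m 0) (ω * m * expCoeff θ ω m 0 a) a := by
  have h := ((((hasDerivAt_id' a).mul_const (ω : ℂ)).cexp).pow m)
  have h2 : expCoeff θ ω m 0 = (fun a => Complex.exp (a * ω)) ^ m := funext fun a => by
    simp [expCoeff]
  rw [h2]
  convert! h using 1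
  cases m with
  | zero => simp
  | succ m =>
    simp
    ring

/-- The equation d/da exp(aΔ) = Δ exp(aΔ) in matrix entries. Its right side has the shape of the
recursion for `deltaCoeff`; differentiating the power of `gamC` produces the shift from m to m + 1,
since (s)_{j+1} = s (s+1)_j. -/
theorem hasDerivAt_expCoeff_succ (θ ω : ℝ) (m j : ℕ) (a : ℂ) :
    HasDerivAt (expCoeff θ ω m (j + 1))
      ((θ + m) * expCoeff θ ω (m + 1) j a + ω * m * expCoeff θ ω m (j + 1) a) a := by
  have h := ((hasDerivAt_expCoeff_zero θ ω m a).mul_const (risingCoeff (θ + m) (j + 1) : ℂ)).mul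
    ((hasDerivAt_gamC ω a).pow (j + 1))
  have h2 : expCoeff θ ω m (j + 1) =
      (fun a => expCoeff θ ω m 0 a * risingCoeff (θ + m) (j + 1)) * gamC ω ^ (j + 1) :=
    funext fun a => by simp [expCoeff]
  have h3 : (risingCoeff (θ + m) (j + 1) : ℂ) * (j + 1) =
      (θ + m) * risingCoeff (θ + m + 1) j := by
    exact_mod_cast risingCoeff_succ_left (θ + m) j
  rw [h2]
  convert! h using 1
  simp only [expCoeff, risingCoeff_zero, pow_zero, Pi.mul_apply, Pi.pow_apply]
  push_cast
  simp only [← add_assoc]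
  linear_combination (-(Complex.exp (a * ω) ^ (m + 1)) * gamC ω a ^ j) * h3

theorem differentiable_expCoeff (θ ω : ℝ) (m j : ℕ) : Differentiable ℂ (expCoeff θ ω m j) := by
  cases j with
  | zero => exact fun a => (hasDerivAt_expCoeff_zero θ ω m a).differentiableAt
  | succ j => exact fun a => (hasDerivAt_expCoeff_succ θ ω m j a).differentiableAt

theorem iteratedDeriv_expCoeff (θ ω : ℝ) (K m j : ℕ) :
    iteratedDeriv K (expCoeff θ ω m j) 0 = deltaCoeff θ ω K m j := by
  induction K generalizing m j with
  | zero => cases j <;> simp [expCoeff, deltaCoeff, gamC_zero]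
  | succ K ih =>
    have hd : ∀ m j, ContDiffAt ℂ K (expCoeff θ ω m j) 0 := fun m j =>
      (differentiable_expCoeff θ ω m j).contDiff.contDiffAt
    rw [iteratedDeriv_succ']
    cases j with
    | zero =>
      rw [funext fun a => (hasDerivAt_expCoeff_zero θ ω m a).deriv,
        iteratedDeriv_const_mul_field, ih, deltaCoeff]
      push_cast
      ring
    | succ j =>
      rw [funext fun a => (hasDerivAt_expCoeff_succ θ ω m j a).deriv,
        iteratedDeriv_fun_add (contDiffAt_const.mul (hd _ _)) (contDiffAt_const.mul (hd _ _)),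
        iteratedDeriv_const_mul_field, iteratedDeriv_const_mul_field, ih,
        ih, deltaCoeff]
      push_cast
      ring

/-- The entries are entire in a, so their Taylor series at 0 converge for every real a. -/
theorem hasSum_expCoeff (θ ω a : ℝ) (m j : ℕ) :
    HasSum (fun K : ℕ => a ^ K / (K ! : ℝ) * deltaCoeff θ ω K m j)
      (Real.exp (a * ω) ^ m * (risingCoeff (θ + m) j * gam a ω ^ j)) := by
  rw [← Complex.hasSum_ofReal, ← expCoeff_ofReal]
  refine (hasSum_egf_iteratedDeriv (differentiable_expCoeff θ ω m j) a).congr_fun fun K => ?_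
  rw [iteratedDeriv_expCoeff]
  push_cast
  ring

theorem iteratedDeriv_exp_mul_zero (a : ℝ) (k : ℕ) :
    iteratedDeriv k (fun z => Complex.exp (a * z)) 0 = (a : ℂ) ^ k := by
  rw [iteratedDeriv_cexp_const_mul]
  simp

/-- Fubini for an absolutely convergent triple series over the power K of Δ, the row m and the
offset j. Summing K first produces the closed form of the operator; summing (m, j) first produces
the K-th term of the exponential series. -/
theorem hasSeries_egf_expDeltaSeq {θ ω a : ℝ} (hθ : 0 ≤ θ) (ha : 0 ≤ a) {f : ℂ → ℂ}
    (hf : Differentiable ℂ f) {B r : ℝ} (hr : 0 ≤ r) (hrγ : r * gam a |ω| < 1)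
    (hu : ∀ k, ‖iteratedDeriv k f 0‖ ≤ B * r ^ k) :
    HasSeries (fun z => Complex.exp (a * z)) θ ω f
      (egf (expDeltaSeq a θ ω fun k => iteratedDeriv k f 0)) := by
  intro z
  have hB : 0 ≤ B := (norm_nonneg _).trans ((hu 0).trans_eq (by simp))
  set u : ℕ → ℂ := fun k => iteratedDeriv k f 0
  let S : (ℕ × ℕ) × ℕ → ℂ := fun p =>
    ((a ^ p.2 / (p.2 ! : ℝ) * deltaCoeff θ ω p.2 p.1.1 p.1.2 : ℝ) : ℂ)
    * (u (p.1.1 + p.1.2) / (p.1.1 ! : ℂ) * z ^ p.1.1)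
  -- The majorant is the same series for |ω| and the bound on `u`. It is summed over K, then j, then
  -- m, by the closed form, the binomial series and the exponential series.
  let M : (ℕ × ℕ) × ℕ → ℝ := fun p => (a ^ p.2 / (p.2 ! : ℝ) * deltaCoeff θ |ω| p.2 p.1.1 p.1.2)
    * (B * r ^ (p.1.1 + p.1.2) / (p.1.1 ! : ℝ) * ‖z‖ ^ p.1.1)
  have hM0 : ∀ K m j, 0 ≤ deltaCoeff θ |ω| K m j := fun K m j =>
    (abs_nonneg _).trans (abs_deltaCoeff_le hθ ω K m j)
  have hM : Summable M := by
    have hK : ∀ m j, HasSum (fun K => M ((m, j), K))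
        ((Real.exp (a * |ω|) ^ m * (risingCoeff (θ + m) j * gam a |ω| ^ j)) *
          (B * r ^ (m + j) / (m ! : ℝ) * ‖z‖ ^ m)) := fun m j =>
      (hasSum_expCoeff θ |ω| a m j).mul_right _
    have hj : ∀ m : ℕ, HasSum (fun j =>
        (Real.exp (a * |ω|) ^ m * (risingCoeff (θ + m) j * gam a |ω| ^ j)) *
          (B * r ^ (m + j) / (m ! : ℝ) * ‖z‖ ^ m))
        (B * (1 - r * gam a |ω|) ^ (-θ) *
          ((Real.exp (a * |ω|) * (r * (1 - r * gam a |ω|)⁻¹) * ‖z‖) ^ m / (m ! : ℝ))) := fun m => by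
      convert! (hasSum_expSeq_bound (θ := θ) (B := B) (gam_nonneg ha |ω|) hr hrγ m).mul_right
        (Real.exp (a * |ω|) ^ m / (m ! : ℝ) * ‖z‖ ^ m) using 1
      · ext j
        rw [mul_pow, pow_add]
        ring
      · rw [mul_pow, mul_pow]
        ring
    have hnn : 0 ≤ M := fun p => by
      have := hM0 p.2 p.1.1 p.1.2
      simp only [M]
      positivity
    refine (summable_prod_of_nonneg hnn).2 ⟨fun p => (hK p.1 p.2).summable, ?_⟩
    have hnn2 : 0 ≤ fun p : ℕ × ℕ => ∑' K, M (p, K) := fun p => tsum_nonneg fun K => hnn _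
    refine (summable_prod_of_nonneg hnn2).2 ⟨fun m => ?_, ?_⟩
    · simp only [fun m j => (hK m j).tsum_eq]
      exact (hj m).summable
    · simp only [fun m j => (hK m j).tsum_eq, fun m => (hj m).tsum_eq]
      exact (Real.summable_pow_div_factorial _).mul_left _
  have hS : Summable S := by
    refine .of_norm_bounded hM fun p => ?_
    simp only [S, M]
    rw [norm_mul, norm_mul, norm_div, norm_pow, Complex.norm_natCast, Complex.norm_real, norm_mul,
      Real.norm_of_nonneg (by positivity : 0 ≤ a ^ p.2 / (p.2 ! : ℝ)), Real.norm_eq_abs]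
    have h1 := abs_deltaCoeff_le hθ ω p.2 p.1.1 p.1.2
    have h2 := hu (p.1.1 + p.1.2)
    have h3 := hM0 p.2 p.1.1 p.1.2
    gcongr
  have hval : HasSum S (egf (expDeltaSeq a θ ω u) z) := by
    have h1 : HasSum (fun p : ℕ × ℕ => ((Real.exp (a * ω) ^ p.1 *
        (risingCoeff (θ + p.1) p.2 * gam a ω ^ p.2) : ℝ) : ℂ) *
          (u (p.1 + p.2) / (p.1 ! : ℂ) * z ^ p.1)) (∑' p, S p) :=
      hS.hasSum.prod_fiberwise fun p => (Complex.hasSum_ofReal.2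
        (hasSum_expCoeff θ ω a p.1 p.2)).mul_right (u (p.1 + p.2) / (p.1 ! : ℂ) * z ^ p.1)
    have h2 := h1.summable.prod_factor
    have h3 := h1.prod_fiberwise (fun m => (h2 m).hasSum)
    convert! hS.hasSum using 1
    rw [← h3.tsum_eq, egf]
    refine tsum_congr fun m => ?_
    rw [expDeltaSeq, expSeq, mul_div_right_comm, mul_assoc, ← tsum_mul_right, ← tsum_mul_left]
    refine tsum_congr fun j => ?_
    push_cast
    ring
  -- The same sum with K as the outer index.
  have hswap := (Equiv.prodComm ℕ (ℕ × ℕ)).hasSum_iff.2 hval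
  refine hswap.prod_fiberwise fun K => ?_
  obtain ⟨hd, hs⟩ := iterate_Delta θ ω hf K
  have h1 := hswap.summable.prod_factor K
  have h2 := h1.hasSum.prod_fiberwise (g := fun m => (a : ℂ) ^ K / (K ! : ℂ) *
      (iteratedDeriv m ((Delta θ ω)^[K] f) 0 / (m ! : ℂ) * z ^ m)) fun m => by
    have h3 := (hasSum_deltaCoeff θ ω u K m).mul_right ((a : ℂ) ^ K / (K ! : ℂ) / (m ! : ℂ) * z ^ m)
    rw [← congrFun hs m] at h3
    convert! h3 using 1
    · ext j
      simp only [S, Function.comp, Equiv.prodComm_apply, Prod.swap]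
      push_cast
      ring
    · ring
  have h4 := (hasSum_egf_iteratedDeriv hd z).mul_left ((a : ℂ) ^ K / (K ! : ℂ))
  rw [iteratedDeriv_exp_mul_zero, ← h2.unique h4]
  exact h1.hasSum

/-! ### Polynomials and the commutation with multiplication by z -/

open Polynomial

/-- The derivatives at `0` of a polynomial. -/
def polySeq (p : ℂ[X]) (k : ℕ) : ℂ := (k ! : ℂ) * p.coeff k

theorem exists_polySeq_bound (p : ℂ[X]) {r : ℝ} (hr : 0 < r) :
    ∃ B, ∀ k, ‖polySeq p k‖ ≤ B * r ^ k := by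
  refine ⟨∑ k ∈ range (p.natDegree + 1), ‖polySeq p k‖ / r ^ k, fun k => ?_⟩
  by_cases hk : k < p.natDegree + 1
  · rw [← div_le_iff₀ (by positivity)]
    exact single_le_sum (f := fun k => ‖polySeq p k‖ / r ^ k) (fun i _ => by positivity)
      (mem_range.2 hk)
  · rw [polySeq, coeff_eq_zero_of_natDegree_lt (by omega)]
    simp only [mul_zero, norm_zero]
    positivity

theorem eval_eq_egf_polySeq (p : ℂ[X]) (z : ℂ) : p.eval z = egf (polySeq p) z := by
  rw [egf, tsum_eq_sum (s := range (p.natDegree + 1)), eval_eq_sum_range]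
  · refine sum_congr rfl fun k _ => ?_
    have h : (k ! : ℂ) ≠ 0 := by exact_mod_cast k.factorial_ne_zero
    rw [polySeq]
    field_simp
  · intro k hk
    rw [polySeq, coeff_eq_zero_of_natDegree_lt (by simpa using hk)]
    simp

theorem iteratedDeriv_eval (p : ℂ[X]) (k : ℕ) :
    iteratedDeriv k (fun z => p.eval z) 0 = polySeq p k := by
  obtain ⟨B, hB⟩ := exists_polySeq_bound p one_pos
  rw [funext (eval_eq_egf_polySeq p), iteratedDeriv_egf hB]

/-- The coefficient of γ^{j+2} u_{k+j+2} in entry k + 1 of E z = (z + γ(θ + 2zD) + γ²(θ + zD)D) E,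
where E = exp(γ(θ + zD)D). The companion for entry 0 is separate because multiplication by z
contributes nothing there. -/
theorem risingCoeff_commutation (θ : ℝ) {s : ℝ} (k j : ℕ) (hs : s = θ + k + 1) :
    risingCoeff s (j + 2) * (k + j + 3) =
      (k + 1) * (risingCoeff (θ + k) (j + 2) + 2 * risingCoeff s (j + 1) + risingCoeff (s + 1) j) +
        θ * (risingCoeff s (j + 1) + risingCoeff (s + 1) j) := by
  have h1 := risingCoeff_succ_left s j
  have h2 := risingCoeff_succ s (j + 1)
  have h3 := risingCoeff_succ_left (θ + k) (j + 1)
  rw [← hs] at h3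
  push_cast at h2 h3
  have hj : (j : ℝ) + 1 ≠ 0 := by positivity
  have hj' : (j : ℝ) + 1 + 1 ≠ 0 := by positivity
  rw [← eq_div_iff hj] at h1
  rw [← eq_div_iff hj', h1] at h2 h3
  rw [show j + 2 = j + 1 + 1 by ring, h2, h3, h1, hs]
  field_simp
  ring

theorem risingCoeff_commutation_zero (θ : ℝ) (j : ℕ) :
    risingCoeff θ (j + 2) * (j + 2) = θ * (risingCoeff θ (j + 1) + risingCoeff (θ + 1) j) := by
  have h1 := risingCoeff_succ_left θ j
  have h2 := risingCoeff_succ θ (j + 1)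
  push_cast at h2
  linear_combination h2 + h1

/-- The action of multiplication by `z` on the sequence of derivatives at `0`. -/
def mulSeq (u : ℕ → ℂ) : ℕ → ℂ
  | 0 => 0
  | k + 1 => (k + 1) * u k

theorem risingCoeff_one (s : ℝ) : risingCoeff s 1 = s := by simp [risingCoeff]

theorem hasSum_expSeq_mulSeq_succ {θ γ : ℝ} (hθ : 0 ≤ θ) (hγ : 0 ≤ γ) {u : ℕ → ℂ} {B r : ℝ}
    (hr : 0 ≤ r) (hrγ : r * γ < 1) (hu : ∀ k, ‖u k‖ ≤ B * r ^ k) (k : ℕ) :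
    HasSum (fun j => ((risingCoeff (θ + (k + 1 : ℕ)) j * γ ^ j : ℝ) : ℂ) * mulSeq u (k + 1 + j))
      ((k + 1) * (expSeq θ γ u k + 2 * γ * expSeq θ γ u (k + 1) + γ ^ 2 * expSeq θ γ u (k + 2)) +
        γ * θ * (expSeq θ γ u (k + 1) + γ * expSeq θ γ u (k + 2))) := by
  have h (k) := (summable_expSeq hθ hγ hr hrγ hu k).hasSum
  have h0 := (hasSum_nat_add_iff' 2).2 (h k)
  have h1 := (hasSum_nat_add_iff' 1).2 (h (k + 1))
  have h2 := h (k + 2)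
  -- The right side involves E at k, k + 1 and k + 2 with weights 1, γ, γ². Dropping 2, 1 and 0
  -- leading terms aligns the powers of γ; the dropped terms are compared at the end.
  rw [← hasSum_nat_add_iff' 2]
  convert! ((h0.add ((h1.mul_left (2 * γ : ℂ)).add (h2.mul_left (γ ^ 2 : ℂ)))).mul_left
    (k + 1 : ℂ)).add ((h1.add (h2.mul_left (γ : ℂ))).mul_left (γ * θ : ℂ)) using 1
  · ext j
    have h3 := risingCoeff_commutation θ k j (s := θ + (k + 1 : ℕ)) (by push_cast; ring)
    have h4 : θ + ((k + 1 : ℕ) : ℝ) + 1 = θ + (k + 2 : ℕ) := by push_cast; ring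
    rw [h4] at h3
    have h5 := congrArg (fun x : ℝ => (x : ℂ)) h3
    push_cast at h5
    have e1 : k + 1 + (j + 2) = (k + (j + 2)) + 1 := by ring
    have e2 : k + 1 + (j + 1) = k + (j + 2) := by ring
    have e3 : k + 2 + j = k + (j + 2) := by ring
    rw [e1, e2, e3, mulSeq]
    push_cast
    linear_combination (γ ^ (j + 2) * u (k + (j + 2)) : ℂ) * h5
  · simp only [sum_range_succ, range_zero, sum_empty, risingCoeff_zero, risingCoeff_one, expSeq,
      mulSeq, show k + 1 + 1 = (k + 1) + 1 from rfl, add_zero]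
    push_cast
    ring

theorem hasSum_expSeq_mulSeq_zero {θ γ : ℝ} (hθ : 0 ≤ θ) (hγ : 0 ≤ γ) {u : ℕ → ℂ} {B r : ℝ}
    (hr : 0 ≤ r) (hrγ : r * γ < 1) (hu : ∀ k, ‖u k‖ ≤ B * r ^ k) :
    HasSum (fun j => ((risingCoeff (θ + (0 : ℕ)) j * γ ^ j : ℝ) : ℂ) * mulSeq u (0 + j))
      (γ * θ * (expSeq θ γ u 0 + γ * expSeq θ γ u 1)) := by
  have h (k) := (summable_expSeq hθ hγ hr hrγ hu k).hasSum
  have h0 := (hasSum_nat_add_iff' 1).2 (h 0)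
  rw [← hasSum_nat_add_iff' 2]
  convert! (h0.add ((h 1).mul_left (γ : ℂ))).mul_left (γ * θ : ℂ) using 1
  · ext j
    have h5 := congrArg (fun x : ℝ => (x : ℂ)) (risingCoeff_commutation_zero θ j)
    push_cast at h5
    have e1 : 0 + (j + 2) = j + 1 + 1 := by ring
    have e2 : 0 + (j + 1) = j + 1 := by ring
    have e3 : 1 + j = j + 1 := by ring
    rw [e1, e2, e3, mulSeq]
    push_cast
    simp only [add_zero]
    linear_combination (γ ^ (j + 2) * u (j + 1) : ℂ) * h5
  · simp only [sum_range_succ, range_zero, sum_empty, risingCoeff_zero, risingCoeff_one, expSeq,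
      mulSeq, zero_add]
    push_cast
    ring

theorem expSeq_mulSeq_succ {θ γ : ℝ} (hθ : 0 ≤ θ) (hγ : 0 ≤ γ) {u : ℕ → ℂ} {B r : ℝ}
    (hr : 0 ≤ r) (hrγ : r * γ < 1) (hu : ∀ k, ‖u k‖ ≤ B * r ^ k) (k : ℕ) :
    expSeq θ γ (mulSeq u) (k + 1) =
      (k + 1) * (expSeq θ γ u k + 2 * γ * expSeq θ γ u (k + 1) + γ ^ 2 * expSeq θ γ u (k + 2)) +
        γ * θ * (expSeq θ γ u (k + 1) + γ * expSeq θ γ u (k + 2)) :=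
  (hasSum_expSeq_mulSeq_succ hθ hγ hr hrγ hu k).tsum_eq

theorem expSeq_mulSeq_zero {θ γ : ℝ} (hθ : 0 ≤ θ) (hγ : 0 ≤ γ) {u : ℕ → ℂ} {B r : ℝ}
    (hr : 0 ≤ r) (hrγ : r * γ < 1) (hu : ∀ k, ‖u k‖ ≤ B * r ^ k) :
    expSeq θ γ (mulSeq u) 0 = γ * θ * (expSeq θ γ u 0 + γ * expSeq θ γ u 1) :=
  (hasSum_expSeq_mulSeq_zero hθ hγ hr hrγ hu).tsum_eq

theorem polySeq_X_mul (p : ℂ[X]) : polySeq (X * p) = mulSeq (polySeq p) := by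
  ext k
  cases k with
  | zero => simp [polySeq, mulSeq]
  | succ k =>
    simp [polySeq, mulSeq, Nat.factorial_succ]
    ring

theorem polySeq_derivative (p : ℂ[X]) (k : ℕ) : polySeq (derivative p) k = polySeq p (k + 1) := by
  simp [polySeq, Nat.factorial_succ, coeff_derivative]
  ring

theorem polySeq_add (p q : ℂ[X]) (k : ℕ) : polySeq (p + q) k = polySeq p k + polySeq q k := by
  simp [polySeq, mul_add]

theorem polySeq_C_mul (s : ℂ) (p : ℂ[X]) (k : ℕ) : polySeq (C s * p) k = s * polySeq p k := by
  simp [polySeq, mul_left_comm]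

/-- The image of `(X + x) p` under `exp (γ (θ + zD) D)`, in terms of the image `g` of `p`. -/
def stepPoly (θ γ x : ℝ) (g : ℂ[X]) : ℂ[X] :=
  C (x : ℂ) * g + (X * (g +
    (C (2 * γ : ℂ) * derivative g + C (γ ^ 2 : ℂ) * derivative (derivative g))) +
    C (γ * θ : ℂ) * (g + C (γ : ℂ) * derivative g))

/-- The commutation relation applied to one linear factor. -/
theorem expSeq_polySeq_step {θ γ : ℝ} (hθ : 0 ≤ θ) (hγ : 0 ≤ γ) (x : ℝ) {p g : ℂ[X]}
    (h : expSeq θ γ (polySeq p) = polySeq g) :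
    expSeq θ γ (polySeq ((X + C (x : ℂ)) * p)) = polySeq (stepPoly θ γ x g) := by
  -- The derivatives of a polynomial are bounded at every positive rate, so r can be taken small
  -- enough for convergence.
  obtain ⟨r, hr, hrγ⟩ : ∃ r : ℝ, 0 < r ∧ r * γ < 1 :=
    ⟨(γ + 1)⁻¹, by positivity, by rw [inv_mul_lt_iff₀ (by positivity)]; linarith⟩
  obtain ⟨B, hB⟩ := exists_polySeq_bound p hr
  obtain ⟨B1, hB1⟩ := exists_polySeq_bound (X * p) hr
  obtain ⟨B2, hB2⟩ := exists_polySeq_bound (C (x : ℂ) * p) hr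
  have e : polySeq ((X + C (x : ℂ)) * p) =
      fun k => polySeq (X * p) k + polySeq (C (x : ℂ) * p) k := by
    ext k
    rw [add_mul, polySeq_add]
  have e2 : polySeq (C (x : ℂ) * p) = fun k => x * polySeq p k := funext fun k => polySeq_C_mul _ _ _
  ext k
  rw [e, expSeq_add hθ hγ hr.le hrγ hB1 hB2, e2, expSeq_const_mul, polySeq_X_mul, stepPoly,
    polySeq_add, polySeq_add, polySeq_C_mul, polySeq_C_mul, polySeq_X_mul, h, polySeq_add,
    polySeq_C_mul, polySeq_derivative]
  cases k with
  | zero =>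
    rw [expSeq_mulSeq_zero hθ hγ hr.le hrγ hB, h]
    simp only [mulSeq]
    ring
  | succ k =>
    rw [expSeq_mulSeq_succ hθ hγ hr.le hrγ hB, h]
    simp only [mulSeq, polySeq_add, polySeq_C_mul, polySeq_derivative]
    ring

/-! ### Preservation of nonpositive roots -/

theorem Multiset.re_sum_nonneg {s : Multiset ℂ} (hs : ∀ a ∈ s, 0 ≤ a.re) : 0 ≤ s.sum.re := by
  induction s using Multiset.induction_on with
  | empty => simp
  | cons a s ih =>
    rw [Multiset.sum_cons, Complex.add_re]
    exact add_nonneg (hs a (by simp)) (ih fun b hb => hs b (by simp [hb]))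

open ComplexConjugate in
/-- Positivity on the right half-plane of the second symmetric function relative to the first. -/
theorem re_conj_mul_sq_sub_pos {s : Multiset ℂ} (hs : ∀ a ∈ s, 0 ≤ a.re) {t : ℂ} (ht : 0 < t.re) :
    0 < (conj (t + s.sum) * ((t + s.sum) ^ 2 - (s.map (· ^ 2)).sum)).re := by
  set ψ := t + s.sum with hψ
  have hψre : 0 < ψ.re := by
    have := Multiset.re_sum_nonneg hs
    rw [hψ, Complex.add_re]
    linarith
  -- Since ψ = t + Σ a, one has ψ² - Σ a² = tψ + Σ a(ψ - a); each summand is treated separately.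
  have h1 : conj ψ * (ψ ^ 2 - (s.map (· ^ 2)).sum) =
      Complex.normSq ψ * t + (s.map fun a => conj ψ * (a * (ψ - a))).sum := by
    have h2 : (s.map fun a => conj ψ * (a * (ψ - a))).sum =
        conj ψ * (s.sum * ψ - (s.map (· ^ 2)).sum) := by
      rw [Multiset.sum_map_mul_left]
      simp only [mul_sub, Multiset.sum_map_sub, Multiset.sum_map_mul_right, Multiset.map_id', sq]
    rw [h2, ← Complex.mul_conj]
    have h3 : s.sum = ψ - t := by rw [hψ]; ring
    rw [h3]
    ring
  rw [h1, Complex.add_re, Complex.re_ofReal_mul]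
  have h4 : 0 < Complex.normSq ψ := Complex.normSq_pos.2 fun h => by simp [h] at hψre
  have h5 : 0 ≤ (s.map fun a => conj ψ * (a * (ψ - a))).sum.re := by
    refine Multiset.re_sum_nonneg fun b hb => ?_
    obtain ⟨a, ha, rfl⟩ := Multiset.mem_map.1 hb
    obtain ⟨s', rfl⟩ := Multiset.exists_cons_of_mem ha
    have h6 : ψ = a + (t + s'.sum) := by rw [hψ, Multiset.sum_cons]; ring
    have h7 : 0 ≤ (t + s'.sum).re := by
      rw [Complex.add_re]
      exact add_nonneg ht.le (Multiset.re_sum_nonneg fun b hb => hs b (by simp [hb]))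
    have h8 := hs a ha
    set ρ := t + s'.sum
    -- With ρ = ψ - a this reads conj(a + ρ)aρ = |a|²ρ + |ρ|²a, and both a and ρ have nonnegative
    -- real part.
    have h9 : conj ψ * (a * (ψ - a)) = Complex.normSq a * ρ + Complex.normSq ρ * a := by
      rw [h6, map_add, ← Complex.mul_conj, ← Complex.mul_conj]
      ring
    rw [h9, Complex.add_re, Complex.re_ofReal_mul, Complex.re_ofReal_mul]
    have := Complex.normSq_nonneg a
    have := Complex.normSq_nonneg ρ
    positivity
  positivity

theorem eval_derivative_prod_X_sub_C (s : Multiset ℂ) {z : ℂ} (hz : z ∉ s) :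
    ((s.map fun a => X - C a).prod.derivative).eval z =
      (s.map fun a => X - C a).prod.eval z * (s.map fun a => (z - a)⁻¹).sum ∧
    ((s.map fun a => X - C a).prod.derivative.derivative).eval z =
      (s.map fun a => X - C a).prod.eval z * ((s.map fun a => (z - a)⁻¹).sum ^ 2 -
        (s.map fun a => (z - a)⁻¹ ^ 2).sum) := by
  induction s using Multiset.induction_on with
  | empty => simp
  | cons a s ih =>
    obtain ⟨h1, h2⟩ := ih fun h => hz (by simp [h])
    have h3 : z - a ≠ 0 := fun h => hz (by simp [sub_eq_zero.1 h])
    simp only [Multiset.map_cons, Multiset.prod_cons, Multiset.sum_cons, derivative_mul, map_add,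
      derivative_sub, derivative_X, derivative_C, sub_zero, one_mul, eval_add, eval_mul, eval_sub,
      eval_X, eval_C, h1, h2]
    constructor
    · field_simp
    · field_simp
      ring

theorem exists_sq_eq_of_mem_slitPlane {z : ℂ} (hz : z ∈ Complex.slitPlane) :
    ∃ w : ℂ, w ^ 2 = z ∧ 0 < w.re := by
  obtain ⟨w, hw⟩ := IsAlgClosed.exists_pow_nat_eq z two_pos
  rcases lt_trichotomy w.re 0 with h | h | h
  · exact ⟨-w, by rw [neg_sq, hw], by simpa using h⟩
  · exfalso
    rw [← hw, Complex.mem_slitPlane_iff, sq, Complex.mul_re, Complex.mul_im, h] at hz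
    rcases hz with h | h
    · nlinarith [mul_self_nonneg w.im]
    · simp at h
  · exact ⟨w, hw, h⟩

/-- The quantity is 1/(w - a/w). For real a ≤ 0 the denominator has positive real part, and
inversion preserves the right half-plane. -/
theorem re_div_sq_sub_nonneg {w a : ℂ} (hw : 0 < w.re) (ha : a ∉ Complex.slitPlane) :
    0 ≤ (w * (w ^ 2 - a)⁻¹).re := by
  have hw0 : w ≠ 0 := fun h => by simp [h] at hw
  have h : w * (w ^ 2 - a)⁻¹ = (w - a * w⁻¹)⁻¹ := by
    have h2 : w - a * w⁻¹ = (w ^ 2 - a) * w⁻¹ := by field_simp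
    rw [h2, mul_inv, inv_inv, mul_comm]
  simp only [Complex.mem_slitPlane_iff, not_or, not_lt, not_not] at ha
  rw [h, Complex.inv_re]
  refine div_nonneg ?_ (Complex.normSq_nonneg _)
  rw [Complex.sub_re, Complex.mul_re, ha.2, zero_mul, sub_zero, Complex.inv_re]
  have : 0 ≤ w.re / Complex.normSq w := div_nonneg hw.le (Complex.normSq_nonneg _)
  nlinarith

/-- Nonzero polynomials all of whose roots lie in `(-∞, 0]`. -/
def NonposRooted (p : ℂ[X]) : Prop := p ≠ 0 ∧ ∀ z ∈ Complex.slitPlane, p.eval z ≠ 0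

open ComplexConjugate in
theorem NonposRooted.stepPoly {θ γ x : ℝ} (hθ : 0 ≤ θ) (hγ : 0 < γ) (hx : 0 ≤ x) {g : ℂ[X]}
    (hg : NonposRooted g) : NonposRooted (stepPoly θ γ x g) := by
  have key : ∀ z ∈ Complex.slitPlane, (LaguerreOp.stepPoly θ γ x g).eval z ≠ 0 := by
    intro z hz
    obtain ⟨w, rfl, hw⟩ := exists_sq_eq_of_mem_slitPlane hz
    have hw0 : w ≠ 0 := fun h => by simp [h] at hw
    have hγ0 : (γ : ℂ) ≠ 0 := by exact_mod_cast hγ.ne'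
    have hgz := hg.2 _ hz
    have hfac := (IsAlgClosed.splits g).eq_prod_roots
    have hroots : ∀ a ∈ g.roots, a ∉ Complex.slitPlane := fun a ha h =>
      hg.2 a h ((mem_roots hg.1).1 ha)
    have hzr : w ^ 2 ∉ g.roots := fun h => hroots _ h hz
    obtain ⟨h1, h2⟩ := eval_derivative_prod_X_sub_C g.roots hzr
    set P := (g.roots.map fun a => X - C a).prod
    have d0 : g.eval (w ^ 2) = g.leadingCoeff * P.eval (w ^ 2) := by
      conv_lhs => rw [hfac]
      simp [P]
    have d1 : g.derivative.eval (w ^ 2) = g.leadingCoeff * P.derivative.eval (w ^ 2) := by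
      conv_lhs => rw [hfac]
      simp [P]
    have d2 : g.derivative.derivative.eval (w ^ 2) =
        g.leadingCoeff * P.derivative.derivative.eval (w ^ 2) := by
      conv_lhs => rw [hfac]
      simp [P]
    -- The logarithmic derivative of g at w², multiplied by w, is a sum of terms in the closed right
    -- half-plane.
    set s : Multiset ℂ := g.roots.map fun a => w * (w ^ 2 - a)⁻¹ with hs
    have hs1 : s.sum = w * (g.roots.map fun a => (w ^ 2 - a)⁻¹).sum := by
      rw [hs, Multiset.sum_map_mul_left]
    have hs2 : (s.map (· ^ 2)).sum = w ^ 2 * (g.roots.map fun a => (w ^ 2 - a)⁻¹ ^ 2).sum := by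
      rw [hs, Multiset.map_map, ← Multiset.sum_map_mul_left]
      simp only [Function.comp, mul_pow]
    have hspos : ∀ a ∈ s, 0 ≤ a.re := fun b hb => by
      obtain ⟨a, ha, rfl⟩ := Multiset.mem_map.1 hb
      exact re_div_sq_sub_nonneg hw (hroots a ha)
    have ht : 0 < ((γ⁻¹ : ℝ) * w).re := by
      rw [Complex.re_ofReal_mul]
      positivity
    have hpos := re_conj_mul_sq_sub_pos hspos ht
    set ψ := ((γ⁻¹ : ℝ) : ℂ) * w + s.sum with hψ
    have hψre : 0 ≤ ψ.re := by
      rw [hψ, Complex.add_re]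
      exact add_nonneg ht.le (Multiset.re_sum_nonneg hspos)
    -- Completing the square: with ψ = w/γ + w g'/g, the terms z(g + 2γg' + γ²g'') become γ²g(ψ² - Σ
    -- s²).
    have hval : (LaguerreOp.stepPoly θ γ x g).eval (w ^ 2) = g.eval (w ^ 2) *
        (x + γ ^ 2 * (ψ ^ 2 - (s.map (· ^ 2)).sum) + γ ^ 2 * θ * (ψ * w⁻¹)) := by
      simp only [LaguerreOp.stepPoly, eval_add, eval_mul, eval_C, eval_X, d0, d1, d2, h1, h2, hψ,
        hs1, hs2]
      push_cast
      field_simp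
      ring
    rw [hval]
    refine mul_ne_zero hgz fun h0 => ?_
    -- After multiplication by conj ψ each of the three terms has nonnegative real part, and the
    -- middle one is strictly positive, so the bracket cannot vanish.
    have h3 : (conj ψ * (x + γ ^ 2 * (ψ ^ 2 - (s.map (· ^ 2)).sum) +
        γ ^ 2 * θ * (ψ * w⁻¹))).re = x * ψ.re +
        γ ^ 2 * (conj ψ * (ψ ^ 2 - (s.map (· ^ 2)).sum)).re +
        γ ^ 2 * θ * Complex.normSq ψ * (w⁻¹).re := by
      have h4 : conj ψ * (x + γ ^ 2 * (ψ ^ 2 - (s.map (· ^ 2)).sum) + γ ^ 2 * θ * (ψ * w⁻¹)) =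
          (x : ℝ) * conj ψ + ((γ ^ 2 : ℝ) : ℂ) * (conj ψ * (ψ ^ 2 - (s.map (· ^ 2)).sum)) +
            ((γ ^ 2 * θ * Complex.normSq ψ : ℝ) : ℂ) * w⁻¹ := by
        push_cast
        rw [← Complex.mul_conj]
        ring
      rw [h4, Complex.add_re, Complex.add_re, Complex.re_ofReal_mul, Complex.re_ofReal_mul,
        Complex.re_ofReal_mul, Complex.conj_re]
    rw [h0, mul_zero, Complex.zero_re] at h3
    have h5 : 0 ≤ (w⁻¹).re := by
      rw [Complex.inv_re]
      exact div_nonneg hw.le (Complex.normSq_nonneg _)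
    have h6 := Complex.normSq_nonneg ψ
    have h7 : 0 < γ ^ 2 * (conj ψ * (ψ ^ 2 - (s.map (· ^ 2)).sum)).re := by positivity
    have h8 : 0 ≤ x * ψ.re := by positivity
    have h9 : 0 ≤ γ ^ 2 * θ * Complex.normSq ψ * (w⁻¹).re := by positivity
    linarith
  exact ⟨fun h => key 1 (by simp) (by simp [h]), key⟩

theorem expSeq_polySeq_one (θ γ : ℝ) : expSeq θ γ (polySeq 1) = polySeq 1 := by
  ext k
  rw [expSeq, tsum_eq_single 0]
  · simp
  · intro j hj
    simp [polySeq, coeff_one, hj]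

/-- `exp (γ (θ + zD) D)` preserves the polynomials with only nonpositive roots. -/
theorem NonposRooted.exists_expSeq {θ γ : ℝ} (hθ : 0 ≤ θ) (hγ : 0 < γ) {p : ℂ[X]}
    (hp : NonposRooted p) : ∃ g, NonposRooted g ∧ expSeq θ γ (polySeq p) = polySeq g := by
  have key : ∀ s : Multiset ℂ, (∀ a ∈ s, a ∉ Complex.slitPlane) →
      ∃ g, NonposRooted g ∧ expSeq θ γ (polySeq (s.map fun a => X - C a).prod) = polySeq g := by
    intro s
    induction s using Multiset.induction_on with
    | empty =>
      intro _
      refine ⟨1, ⟨one_ne_zero, by simp⟩, ?_⟩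
      simp only [Multiset.map_zero, Multiset.prod_zero]
      exact expSeq_polySeq_one θ γ
    | cons a s ih =>
      intro hs
      obtain ⟨g, hg, hgs⟩ := ih fun b hb => hs b (by simp [hb])
      have ha := hs a (by simp)
      simp only [Complex.mem_slitPlane_iff, not_or, not_lt, not_not] at ha
      -- A root a ≤ 0 contributes the factor X + x with x = -a ≥ 0, the situation of the one-factor
      -- step.
      have e : (X - C a : ℂ[X]) = X + C ((-a.re : ℝ) : ℂ) := by
        have : a = (a.re : ℂ) := Complex.ext rfl (by simp [ha.2])
        conv_lhs => rw [this]
        simp [sub_eq_add_neg]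
      refine ⟨_, hg.stepPoly hθ hγ (x := -a.re) (by linarith), ?_⟩
      rw [Multiset.map_cons, Multiset.prod_cons, e]
      exact expSeq_polySeq_step hθ hγ.le _ hgs
  obtain ⟨g, hg, hgs⟩ := key p.roots fun a ha h => hp.2 a h ((mem_roots hp.1).1 ha)
  have hlc : p.leadingCoeff ≠ 0 := leadingCoeff_ne_zero.2 hp.1
  refine ⟨C p.leadingCoeff * g, ⟨mul_ne_zero (C_ne_zero.2 hlc) hg.1, fun z hz => ?_⟩, ?_⟩
  · rw [eval_mul, eval_C]
    exact mul_ne_zero hlc (hg.2 z hz)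
  · ext k
    conv_lhs => rw [(IsAlgClosed.splits p).eq_prod_roots]
    rw [polySeq_C_mul, ← hgs, ← expSeq_const_mul]
    congr 1
    ext k
    exact polySeq_C_mul _ _ _

/-! ### Limits of polynomials with nonpositive roots -/

theorem prod_range_getD {M : Type*} [CommMonoid M] (f : ℝ → M) (L : List ℝ) :
    ∏ j ∈ range L.length, f (L.getD j 0) = (L.map f).prod := by
  induction L with
  | nil => simp
  | cons a L ih => simp [prod_range_succ', ← ih, mul_comm]

theorem antitone_getD {L : List ℝ} (h : L.Pairwise (· ≥ ·)) (h0 : ∀ x ∈ L, 0 ≤ x) :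
    Antitone fun j => L.getD j 0 := by
  intro i j hij
  by_cases hj : j < L.length
  · have hi : i < L.length := hij.trans_lt hj
    simp only [List.getD_eq_getElem _ _ hj, List.getD_eq_getElem _ _ hi]
    rcases hij.eq_or_lt with rfl | hij
    · exact le_rfl
    · exact List.pairwise_iff_getElem.1 h i j hi hj hij
  · simp only [List.getD_eq_default _ _ (not_lt.1 hj)]
    by_cases hi : i < L.length
    · rw [List.getD_eq_getElem _ _ hi]
      exact h0 _ (List.getElem_mem hi)
    · rw [List.getD_eq_default _ _ (not_lt.1 hi)]

/-- A polynomial with only negative roots in the normalized form `p(0) ∏ (1 + β_j z)`. -/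
theorem NonposRooted.exists_eval_eq {p : ℂ[X]} (hp : NonposRooted p) (h0 : p.eval 0 ≠ 0) :
    ∃ (N : ℕ) (β : ℕ → ℝ), (∀ j, 0 ≤ β j) ∧ Antitone β ∧ (∀ j, N ≤ j → β j = 0) ∧
      (∀ z, p.eval z = p.eval 0 * ∏ j ∈ range N, (1 + (β j : ℂ) * z)) ∧
      p.derivative.eval 0 = p.eval 0 * ((∑ j ∈ range N, β j : ℝ) : ℂ) := by
  have hroots : ∀ a ∈ p.roots, a ≠ 0 ∧ (((-a⁻¹).re : ℝ) : ℂ) = -a⁻¹ ∧ 0 ≤ (-a⁻¹).re := by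
    intro a ha
    have hroot : p.eval a = 0 := (mem_roots hp.1).1 ha
    have h1 : a ∉ Complex.slitPlane := fun h => hp.2 a h hroot
    simp only [Complex.mem_slitPlane_iff, not_or, not_lt, not_not] at h1
    refine ⟨fun h => h0 (h ▸ hroot), ?_, ?_⟩
    · exact Complex.ext rfl (by simp [h1.2])
    · rw [Complex.neg_re, Complex.inv_re, ← neg_div]
      exact div_nonneg (by linarith) (Complex.normSq_nonneg _)
  let s : Multiset ℝ := p.roots.map fun a => (-a⁻¹).re
  let L := s.sort (· ≥ ·)
  have hLs : (L : Multiset ℝ) = s := Multiset.sort_eq _ _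
  have hL0 : ∀ x ∈ L, 0 ≤ x := fun x hx => by
    obtain ⟨a, ha, rfl⟩ := Multiset.mem_map.1 ((Multiset.mem_sort _).1 hx)
    exact (hroots a ha).2.2
  have hfac := (IsAlgClosed.splits p).eq_prod_roots
  have hev : ∀ z, p.eval z = p.leadingCoeff * (p.roots.map fun a => z - a).prod := fun z => by
    conv_lhs => rw [hfac]
    simp [eval_multiset_prod, Multiset.map_map]
  -- The β_j are the numbers -1/a over the roots a, sorted decreasingly and padded by zeros.
  refine ⟨L.length, fun j => L.getD j 0, fun j => ?_, antitone_getD (Multiset.pairwise_sort _ _) hL0,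
    fun j hj => List.getD_eq_default _ _ hj, fun z => ?_, ?_⟩
  · by_cases hj : j < L.length
    · simp only [List.getD_eq_getElem _ _ hj]
      exact hL0 _ (List.getElem_mem hj)
    · simp only [List.getD_eq_default _ _ (not_lt.1 hj), le_refl]
  · rw [prod_range_getD (fun x => 1 + (x : ℂ) * z), ← Multiset.prod_coe, ← Multiset.map_coe, hLs,
      Multiset.map_map, hev z, hev 0, mul_assoc, ← Multiset.prod_map_mul]
    congr 2
    refine Multiset.map_congr rfl fun a ha => ?_
    obtain ⟨ha0, hre, -⟩ := hroots a ha
    simp only [Function.comp, hre]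
    field_simp
    ring
  · have hz : (0 : ℂ) ∉ p.roots := fun h => h0 ((mem_roots hp.1).1 h)
    have h1 := (eval_derivative_prod_X_sub_C p.roots hz).1
    have h2 : p.derivative.eval 0 = p.eval 0 * (p.roots.map fun a => (0 - a)⁻¹).sum := by
      conv_lhs => rw [hfac]
      rw [derivative_C_mul, eval_C_mul, h1, hev 0]
      simp [eval_multiset_prod, Multiset.map_map, mul_assoc]
    have h3 : ∑ j ∈ range L.length, L.getD j 0 = L.sum := by
      have := prod_range_getD (fun x => Multiplicative.ofAdd x) L
      have h4 := congrArg Multiplicative.toAdd this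
      simpa [toAdd_prod, Function.comp_def] using h4
    rw [h2, h3, ← Multiset.sum_coe, hLs]
    congr 1
    have h5 : ((s.sum : ℝ) : ℂ) = (s.map fun x : ℝ => (x : ℂ)).sum :=
      map_multiset_sum Complex.ofRealHom s
    rw [h5, Multiset.map_map]
    refine congrArg _ (Multiset.map_congr rfl fun a ha => ?_)
    simp only [Function.comp, (hroots a ha).2.1]
    rw [zero_sub, inv_neg]

/-- The factor e^{-x} removes the linear term. The quadratic bound matters because the β_j of the
approximants are only dominated by S/(j + 1), which is square summable but not summable. -/
theorem norm_one_add_mul_exp_neg_sub_one_le (x : ℂ) :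
    ‖(1 + x) * Complex.exp (-x) - 1‖ ≤ ‖x‖ ^ 2 * Real.exp (2 * ‖x‖) := by
  have h1 : (1 + x) * Complex.exp (-x) - 1 = -(Complex.exp (-x) * (Complex.exp x - (1 + x))) := by
    rw [mul_sub, ← Complex.exp_add]
    simp
    ring
  have h2 := Complex.norm_exp_sub_sum_le_norm_mul_exp x 2
  simp only [sum_range_succ, range_zero, sum_empty, pow_zero, Nat.factorial_zero, Nat.cast_one,
    div_one, zero_add, pow_one, Nat.factorial_one] at h2
  have h3 : ‖Complex.exp (-x)‖ ≤ Real.exp ‖x‖ := by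
    simpa using Complex.norm_exp_le_exp_norm (-x)
  rw [h1, norm_neg, norm_mul]
  calc _ ≤ Real.exp ‖x‖ * (‖x‖ ^ 2 * Real.exp ‖x‖) := by gcongr
    _ = _ := by rw [two_mul, Real.exp_add]; ring

theorem tprod_one_add_mul_exp_neg {b : ℕ → ℝ} (hb : Summable b) (z : ℂ) :
    ∏' j, (1 + (b j : ℂ) * z) * Complex.exp (-((b j : ℂ) * z)) =
      (∏' j, (1 + (b j : ℂ) * z)) * Complex.exp (-(((∑' j, b j : ℝ) : ℂ) * z)) := by
  have h1 : HasSum (fun j => (b j : ℂ) * z) (((∑' j, b j : ℝ) : ℂ) * z) :=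
    (Complex.hasSum_ofReal.2 hb.hasSum).mul_right z
  have h2 : Multipliable fun j => 1 + (b j : ℂ) * z :=
    Complex.multipliable_one_add_of_summable h1.summable
  have h3 := h1.neg.cexp
  rw [← h3.tprod_eq]
  exact h2.tprod_mul h3.multipliable

/-- A limit, nonzero at `0`, of polynomials with only nonpositive roots is in `𝓛⁺`. -/
theorem isLaguerre_of_tendsto {q : ℕ → ℂ[X]} (hq : ∀ n, NonposRooted (q n)) {F : ℂ → ℂ} {D : ℂ}
    (hF : ∀ z, Tendsto (fun n => (q n).eval z) atTop (𝓝 (F z)))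
    (hD : Tendsto (fun n => (q n).derivative.eval 0) atTop (𝓝 D)) (h0 : F 0 ≠ 0) :
    IsLaguerre F := by
  obtain ⟨n₀, hn₀⟩ := eventually_atTop.1 ((hF 0).eventually_ne h0)
  have hex := fun n => (hq (n + n₀)).exists_eval_eq (hn₀ _ (Nat.le_add_left _ _))
  choose N β hβ0 hβ hβN hev hder using hex
  have hF' (z) := (tendsto_add_atTop_iff_nat n₀).2 (hF z)
  have hD' := (tendsto_add_atTop_iff_nat n₀).2 hD
  -- The sum of the β_j equals q'(0)/q(0), so it converges along the sequence.
  set σ : ℕ → ℝ := fun n => ∑ j ∈ range (N n), β n j with hσdef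
  have hσ : Tendsto (fun n => (σ n : ℂ)) atTop (𝓝 (D / F 0)) := by
    refine (hD'.div (hF' 0) h0).congr fun n => ?_
    rw [Pi.div_apply, hder n, mul_div_cancel_left₀ _ (hn₀ _ (Nat.le_add_left _ _))]
  have hσre : Tendsto σ atTop (𝓝 (D / F 0).re) := by
    exact (Complex.continuous_re.tendsto _).comp hσ
  set σ₀ := (D / F 0).re
  have hσ' : Tendsto (fun n => (σ n : ℂ)) atTop (𝓝 (σ₀ : ℂ)) :=
    (Complex.continuous_ofReal.tendsto _).comp hσre
  obtain ⟨S, hS⟩ := hσre.bddAbove_range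
  have hS' : ∀ n, σ n ≤ S := fun n => hS ⟨n, rfl⟩
  have hpart : ∀ n (t : Finset ℕ), ∑ j ∈ t, β n j ≤ σ n := fun n t => by
    have h1 : ∑ j ∈ t, β n j = ∑ j ∈ t.filter (· < N n), β n j := by
      rw [sum_filter]
      refine sum_congr rfl fun j _ => ?_
      split_ifs with h
      · rfl
      · exact hβN n j (not_lt.1 h)
    rw [h1]
    refine sum_le_sum_of_subset_of_nonneg (fun j hj => ?_) fun j _ _ => hβ0 n j
    exact mem_range.2 (mem_filter.1 hj).2
  -- Monotonicity gives (j + 1)β_j ≤ β_0 + ⋯ + β_j ≤ S.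
  have hβS : ∀ n j, β n j ≤ S / (j + 1) := fun n j => by
    rw [le_div_iff₀ (by positivity)]
    calc β n j * (j + 1) = ∑ i ∈ range (j + 1), β n j := by simp [mul_comm]
      _ ≤ ∑ i ∈ range (j + 1), β n i :=
        sum_le_sum fun i hi => hβ n (Nat.lt_succ_iff.1 (mem_range.1 hi))
      _ ≤ S := (hpart n _).trans (hS' n)
  have hS0 : 0 ≤ S := (sum_nonneg fun j _ => hβ0 0 j).trans (hS' 0)
  have hβS' : ∀ n j, β n j ≤ S := fun n j => (hβS n j).trans
    (div_le_self hS0 (by linarith [(Nat.cast_nonneg j : (0 : ℝ) ≤ j)]))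
  obtain ⟨b, -, τ, hτ, hlim⟩ := (isCompact_univ_pi fun _ : ℕ => isCompact_Icc
    (a := (0 : ℝ)) (b := S)).tendsto_subseq (x := β) fun n j _ => ⟨hβ0 n j, hβS' n j⟩
  have hlim' : ∀ j, Tendsto (fun n => β (τ n) j) atTop (𝓝 (b j)) := fun j =>
    (tendsto_pi_nhds.1 hlim) j
  have hb0 : ∀ j, 0 ≤ b j := fun j => ge_of_tendsto' (hlim' j) fun n => hβ0 _ j
  have hbanti : Antitone b := fun i j hij => le_of_tendsto_of_tendsto' (hlim' j) (hlim' i)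
    fun n => hβ _ hij
  have hbpart : ∀ t : Finset ℕ, ∑ j ∈ t, b j ≤ σ₀ := fun t =>
    le_of_tendsto_of_tendsto' (tendsto_finsetSum t fun j _ => hlim' j)
      (hσre.comp hτ.tendsto_atTop) fun n => hpart _ t
  have hbsum : Summable b := summable_of_sum_le hb0 hbpart
  have hbtsum : ∑' j, b j ≤ σ₀ := hbsum.tsum_le_of_sum_le hbpart
  -- The exponent is the mass lost when passing to the limit termwise; it is nonnegative by the
  -- bound on partial sums.
  refine ⟨F 0, 0, σ₀ - ∑' j, b j, b, by linarith, hb0, hbanti, hbsum, fun z => ?_⟩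
  have hdom : Tendsto (fun n => ∏' j, (1 + ((1 + (β (τ n) j : ℂ) * z) *
      Complex.exp (-((β (τ n) j : ℂ) * z)) - 1))) atTop
      (𝓝 (∏' j, (1 + ((1 + (b j : ℂ) * z) * Complex.exp (-((b j : ℂ) * z)) - 1)))) := by
    refine tendsto_tprod_one_add_of_dominated_convergence
      (bound := fun j : ℕ => ((S * ‖z‖) ^ 2 * Real.exp (2 * (S * ‖z‖))) * (1 / ((j + 1 : ℕ) : ℝ) ^ 2))
      ?_ (fun j => ?_) (Eventually.of_forall fun n j => ?_)
    · exact (((summable_nat_add_iff 1).2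
        (Real.summable_one_div_nat_pow.2 one_lt_two)).mul_left _)
    · have h1 : Tendsto (fun n => (β (τ n) j : ℂ) * z) atTop (𝓝 ((b j : ℂ) * z)) :=
        ((Complex.continuous_ofReal.tendsto _).comp (hlim' j)).mul_const z
      exact ((h1.const_add 1).mul h1.neg.cexp).sub_const 1
    · refine (norm_one_add_mul_exp_neg_sub_one_le _).trans ?_
      have h1 : ‖(β (τ n) j : ℂ) * z‖ = β (τ n) j * ‖z‖ := by
        rw [norm_mul, Complex.norm_real, Real.norm_of_nonneg (hβ0 _ j)]
      rw [h1]
      have h2 := hβ0 (τ n) j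
      calc (β (τ n) j * ‖z‖) ^ 2 * Real.exp (2 * (β (τ n) j * ‖z‖))
          ≤ (S / (j + 1) * ‖z‖) ^ 2 * Real.exp (2 * (S * ‖z‖)) := by
            gcongr
            · exact hβS _ j
            · exact hβS' _ j
        _ = _ := by
          push_cast
          field_simp
  simp only [add_sub_cancel] at hdom
  rw [tprod_one_add_mul_exp_neg hbsum] at hdom
  -- The compensated product is q(z)/q(0) times e^{-σz}, so its limit determines F.
  have hfin : ∀ n, ∏' j, (1 + (β (τ n) j : ℂ) * z) * Complex.exp (-((β (τ n) j : ℂ) * z)) =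
      (q (τ n + n₀)).eval z / (q (τ n + n₀)).eval 0 * Complex.exp (-((σ (τ n) : ℂ) * z)) := by
    intro n
    rw [tprod_eq_prod (s := range (N (τ n))), prod_mul_distrib, hev (τ n) z,
      mul_div_cancel_left₀ _ (hn₀ _ (Nat.le_add_left _ _)), ← Complex.exp_sum, sum_neg_distrib,
      ← sum_mul]
    · simp [hσdef]
    · intro j hj
      rw [hβN _ j (by simpa using hj)]
      simp
  simp only [hfin] at hdom
  have hlimF : Tendsto (fun n => (q (τ n + n₀)).eval z / (q (τ n + n₀)).eval 0 *
      Complex.exp (-((σ (τ n) : ℂ) * z))) atTop (𝓝 (F z / F 0 * Complex.exp (-((σ₀ : ℂ) * z)))) :=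
    (((hF' z).comp hτ.tendsto_atTop).div ((hF' 0).comp hτ.tendsto_atTop) h0).mul
      (((hσ'.comp hτ.tendsto_atTop).mul_const z).neg.cexp)
  have heq := tendsto_nhds_unique hlimF hdom
  have hexp : Complex.exp (-((σ₀ : ℂ) * z)) * Complex.exp ((σ₀ : ℂ) * z) = 1 := by
    rw [← Complex.exp_add]
    simp
  have hsplit : Complex.exp (((σ₀ - ∑' j, b j : ℝ) : ℂ) * z) =
      Complex.exp ((σ₀ : ℂ) * z) * Complex.exp (-(((∑' j, b j : ℝ) : ℂ) * z)) := by
    rw [← Complex.exp_add]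
    congr 1
    push_cast
    ring
  have hdiv : F z = F 0 * (F z / F 0) := by field_simp
  rw [hsplit, pow_zero, mul_one]
  linear_combination hdiv - F 0 * (F z / F 0) * hexp + F 0 * Complex.exp ((σ₀ : ℂ) * z) * heq

/-! ### Cauchy estimates and convergence of derivatives -/

theorem iteratedDeriv_eq_circleIntegral {f : ℂ → ℂ} (hf : Differentiable ℂ f) (k : ℕ) :
    iteratedDeriv k f 0 = (2 * Real.pi * Complex.I / (k ! : ℂ))⁻¹ *
      ∮ z in C(0, 1), (1 / (z - 0) ^ (k + 1)) • f z := by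
  rw [DiffContOnCl.circleIntegral_one_div_sub_center_pow_smul one_pos k hf.diffContOnCl,
    smul_eq_mul, inv_mul_cancel_left₀]
  simp [Nat.factorial_ne_zero, Real.pi_ne_zero]

/-- Derivatives at `0` converge under bounded pointwise convergence of entire functions. -/
theorem tendsto_iteratedDeriv_of_tendsto {g : ℕ → ℂ → ℂ} {f : ℂ → ℂ}
    (hg : ∀ n, Differentiable ℂ (g n)) (hf : Differentiable ℂ f)
    (hlim : ∀ z, Tendsto (fun n => g n z) atTop (𝓝 (f z))) {M : ℝ}
    (hM : ∀ n z, ‖z‖ = 1 → ‖g n z‖ ≤ M) (k : ℕ) :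
    Tendsto (fun n => iteratedDeriv k (g n) 0) atTop (𝓝 (iteratedDeriv k f 0)) := by
  simp only [fun n => iteratedDeriv_eq_circleIntegral (hg n) k,
    iteratedDeriv_eq_circleIntegral hf k]
  refine Tendsto.const_mul _ ?_
  simp only [circleIntegral]
  refine intervalIntegral.tendsto_integral_filter_of_dominated_convergence (fun _ => M)
    (Eventually.of_forall fun n => ?_) (Eventually.of_forall fun n => ?_)
    intervalIntegrable_const ?_
  · refine Continuous.aestronglyMeasurable ?_
    have h1 : Continuous (circleMap 0 1) := continuous_circleMap 0 1
    have h2 : Continuous (g n) := (hg n).continuous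
    simp only [deriv_circleMap, sub_zero, one_div]
    have h3 : Continuous fun t => (circleMap 0 1 t ^ (k + 1))⁻¹ :=
      (h1.pow _).inv₀ fun t => pow_ne_zero _ (circleMap_ne_center one_ne_zero)
    exact (h1.mul continuous_const).smul (h3.smul (h2.comp h1))
  · refine Eventually.of_forall fun t _ => ?_
    have h1 : ‖circleMap 0 1 t‖ = 1 := by simp
    simpa [deriv_circleMap, h1] using hM n _ h1
  · exact Eventually.of_forall fun t _ => ((hlim _).const_smul _).const_smul _

/-- The Stirling sequence decreases from its value e/√2 at 1; afterwards √k is bounded by k. -/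
theorem factorial_le_mul_pow (k : ℕ) (hk : k ≠ 0) :
    (k ! : ℝ) ≤ Real.exp 1 * k * (k / Real.exp 1) ^ k := by
  obtain ⟨j, rfl⟩ := Nat.exists_eq_succ_of_ne_zero hk
  have h := Stirling.stirlingSeq'_antitone (Nat.zero_le j)
  simp only [Function.comp, Nat.succ_eq_add_one, zero_add, Stirling.stirlingSeq_one] at h
  rw [Stirling.stirlingSeq, div_le_iff₀ (by positivity), Real.sqrt_mul (by norm_num)] at h
  have h2 : √((j + 1 : ℕ) : ℝ) ≤ ((j + 1 : ℕ) : ℝ) := by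
    rw [Real.sqrt_le_left (by positivity)]
    have : (1 : ℝ) ≤ ((j + 1 : ℕ) : ℝ) := by exact_mod_cast Nat.succ_pos j
    nlinarith
  calc _ ≤ _ := h
    _ = Real.exp 1 * √((j + 1 : ℕ) : ℝ) * (((j + 1 : ℕ) : ℝ) / Real.exp 1) ^ (j + 1) := by
      field_simp
    _ ≤ _ := by gcongr

theorem norm_iteratedDeriv_le_of_exp_bound {g : ℂ → ℂ} (hg : Differentiable ℂ g) {B r : ℝ}
    (hr : 0 < r) (hB : ∀ z, ‖g z‖ ≤ B * Real.exp (r * ‖z‖)) (k : ℕ) :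
    ‖iteratedDeriv k g 0‖ ≤ B * (Real.exp 1 * (k + 1) * r ^ k) := by
  have hB0 : 0 ≤ B := (norm_nonneg _).trans ((hB 0).trans_eq (by simp))
  rcases eq_or_ne k 0 with rfl | hk
  · have h1 := hB 0
    have h2 : 1 ≤ Real.exp 1 := Real.one_le_exp zero_le_one
    simp only [norm_zero, mul_zero, Real.exp_zero, mul_one] at h1
    simp only [iteratedDeriv_zero, Nat.cast_zero, zero_add, mul_one, pow_zero]
    nlinarith
  · have hk' : (0 : ℝ) < k := by positivity
    -- The radius k/r minimizes e^{rR}/R^k in the Cauchy estimate.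
    have h1 := Complex.norm_iteratedDeriv_le_of_forall_mem_sphere_norm_le k
      (R := k / r) (C := B * Real.exp k) (c := 0) (by positivity) hg.diffContOnCl fun z hz => by
        refine (hB z).trans_eq ?_
        rw [mem_sphere_zero_iff_norm.1 hz, mul_div_cancel₀ _ hr.ne']
    refine h1.trans ?_
    have h2 := factorial_le_mul_pow k hk
    have h3 : Real.exp k = Real.exp 1 ^ k := by rw [← Real.exp_nat_mul, mul_one]
    calc (k ! : ℝ) * (B * Real.exp k) / (k / r) ^ k
        ≤ (Real.exp 1 * k * (k / Real.exp 1) ^ k) * (B * Real.exp k) / (k / r) ^ k := by gcongr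
      _ = B * (Real.exp 1 * k * r ^ k) := by
        rw [h3, div_pow, div_pow]
        field_simp
      _ ≤ _ := by
        gcongr
        linarith

/-- The linear factor lost in the Cauchy estimate is absorbed by a slightly larger rate. -/
theorem exists_succ_mul_pow_le {r r' : ℝ} (hr : 0 < r) (h : r < r') :
    ∃ K, ∀ k : ℕ, Real.exp 1 * (k + 1) * r ^ k ≤ K * r' ^ k := by
  have hr' : 0 < r' := hr.trans h
  have h1 : Summable fun k : ℕ => (k : ℝ) ^ 1 * (r / r') ^ k :=
    summable_pow_mul_geometric_of_norm_lt_one 1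
      (by rw [Real.norm_of_nonneg (by positivity), div_lt_one hr']; exact h)
  have h2 : Summable fun k : ℕ => (r / r') ^ k :=
    summable_geometric_of_lt_one (by positivity) ((div_lt_one hr').2 h)
  obtain ⟨K, hK⟩ := ((h1.add h2).mul_left (Real.exp 1)).tendsto_atTop_zero.bddAbove_range
  refine ⟨K, fun k => ?_⟩
  have h3 := hK ⟨k, rfl⟩
  simp only [pow_one, div_pow] at h3
  rw [← div_le_iff₀ (by positivity)]
  refine le_trans (le_of_eq ?_) h3
  field_simp

theorem tendsto_expSeq {θ γ : ℝ} (hθ : 0 ≤ θ) (hγ : 0 ≤ γ) {u : ℕ → ℕ → ℂ} {v : ℕ → ℂ} {B r : ℝ}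
    (hr : 0 ≤ r) (hrγ : r * γ < 1) (hu : ∀ n k, ‖u n k‖ ≤ B * r ^ k)
    (hlim : ∀ k, Tendsto (fun n => u n k) atTop (𝓝 (v k))) (k : ℕ) :
    Tendsto (fun n => expSeq θ γ (u n) k) atTop (𝓝 (expSeq θ γ v k)) :=
  tendsto_tsum_of_dominated_convergence (hasSum_expSeq_bound hγ hr hrγ k).summable
    (fun j => (hlim (k + j)).const_mul _)
    (Eventually.of_forall fun n j => norm_expSeq_term_le hθ hγ (hu n) k j)

theorem tendsto_egf {u : ℕ → ℕ → ℂ} {v : ℕ → ℂ} {B r : ℝ} (hu : ∀ n k, ‖u n k‖ ≤ B * r ^ k)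
    (hlim : ∀ k, Tendsto (fun n => u n k) atTop (𝓝 (v k))) (z : ℂ) :
    Tendsto (fun n => egf (u n) z) atTop (𝓝 (egf v z)) :=
  tendsto_tsum_of_dominated_convergence (summable_egf_bound B r ‖z‖)
    (fun k => ((hlim k).div_const _).mul_const _)
    (Eventually.of_forall fun n k => norm_egf_term_le (hu n) le_rfl k)

/-! ### Polynomial approximation of Laguerre functions -/

/-- The Laguerre entire function with parameters `m`, `α`, `β`. -/
def laguerreFun (m : ℕ) (α : ℝ) (β : ℕ → ℝ) (z : ℂ) : ℂ :=
  z ^ m * Complex.exp (α * z) * ∏' j, (1 + (β j : ℂ) * z)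

/-- Polynomials approximating `laguerreFun m α β`. -/
def laguerrePoly (m : ℕ) (α : ℝ) (β : ℕ → ℝ) (n : ℕ) : ℂ[X] :=
  X ^ m * (1 + C ((α / n : ℝ) : ℂ) * X) ^ n * ∏ j ∈ range n, (1 + C (β j : ℂ) * X)

theorem NonposRooted.mul {p q : ℂ[X]} (hp : NonposRooted p) (hq : NonposRooted q) :
    NonposRooted (p * q) :=
  ⟨mul_ne_zero hp.1 hq.1, fun z hz => by
    rw [eval_mul]
    exact mul_ne_zero (hp.2 z hz) (hq.2 z hz)⟩

theorem nonposRooted_one : NonposRooted 1 := ⟨one_ne_zero, by simp⟩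

theorem NonposRooted.pow {p : ℂ[X]} (hp : NonposRooted p) (n : ℕ) : NonposRooted (p ^ n) := by
  induction n with
  | zero => simpa using nonposRooted_one
  | succ n ih => exact pow_succ p n ▸ ih.mul hp

theorem nonposRooted_X : NonposRooted X :=
  ⟨X_ne_zero, fun z hz => by simpa using Complex.slitPlane_ne_zero hz⟩

theorem nonposRooted_one_add {x : ℝ} (hx : 0 ≤ x) : NonposRooted (1 + C (x : ℂ) * X) := by
  have key : ∀ z ∈ Complex.slitPlane, (1 + C (x : ℂ) * X).eval z ≠ 0 := by
    intro z hz h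
    simp only [eval_add, eval_one, eval_mul, eval_C, eval_X] at h
    have hre := congrArg Complex.re h
    have him := congrArg Complex.im h
    simp only [Complex.add_re, Complex.add_im, Complex.one_re, Complex.one_im,
      Complex.re_ofReal_mul, Complex.im_ofReal_mul, Complex.zero_re, Complex.zero_im,
      zero_add] at hre him
    rcases mul_eq_zero.1 him with h0 | h0
    · simp [h0] at hre
    · rcases Complex.mem_slitPlane_iff.1 hz with h1 | h1
      · nlinarith
      · exact h1 h0
  exact ⟨fun h => key 1 (by simp) (by simp [h]), key⟩

section laguerrePoly

variable {α : ℝ} {β : ℕ → ℝ}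

theorem nonposRooted_laguerrePoly (m : ℕ) (hα : 0 ≤ α) (hβ : ∀ j, 0 ≤ β j) (n : ℕ) :
    NonposRooted (laguerrePoly m α β n) := by
  refine ((nonposRooted_X.pow m).mul
    ((nonposRooted_one_add (by positivity : 0 ≤ α / n)).pow n)).mul ?_
  exact prod_induction _ _ (fun _ _ => NonposRooted.mul) nonposRooted_one
    fun j _ => nonposRooted_one_add (hβ j)

theorem eval_laguerrePoly (m n : ℕ) (z : ℂ) : (laguerrePoly m α β n).eval z =
    z ^ m * (1 + (α : ℂ) * z / n) ^ n * ∏ j ∈ range n, (1 + (β j : ℂ) * z) := by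
  simp [laguerrePoly, eval_prod, div_mul_eq_mul_div]

theorem tendsto_prod_one_add_mul (hβs : Summable β) (z : ℂ) :
    Tendsto (fun n => ∏ j ∈ range n, (1 + (β j : ℂ) * z)) atTop
      (𝓝 (∏' j, (1 + (β j : ℂ) * z))) :=
  (Complex.multipliable_one_add_of_summable
    ((Complex.hasSum_ofReal.2 hβs.hasSum).mul_right z).summable).hasProd.tendsto_prod_nat

theorem tendsto_eval_laguerrePoly (m : ℕ) (hβs : Summable β) (z : ℂ) :
    Tendsto (fun n => (laguerrePoly m α β n).eval z) atTop (𝓝 (laguerreFun m α β z)) := by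
  simp only [eval_laguerrePoly]
  exact ((Complex.tendsto_one_add_div_pow_exp _).const_mul _).mul (tendsto_prod_one_add_mul hβs z)

/-- Because α and the β_j are nonnegative, |p_n(z)| ≤ p_n(|z|), and p_n(|z|) is at most the limit
function at |z|: (1 + αR/n)^n ≤ e^{αR}, and the partial products increase. This yields a growth
bound uniform in n. -/
theorem norm_eval_laguerrePoly_le (m : ℕ) (hα : 0 ≤ α) (hβ : ∀ j, 0 ≤ β j) (hβs : Summable β)
    (n : ℕ) (z : ℂ) :
    ‖(laguerrePoly m α β n).eval z‖ ≤ ‖laguerreFun m α β (‖z‖ : ℂ)‖ := by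
  set R := ‖z‖
  have hR : 0 ≤ R := norm_nonneg z
  have hone : ∀ x : ℝ, 0 ≤ x → ‖1 + (x : ℂ) * z‖ ≤ 1 + x * R := fun x hx => by
    refine (norm_add_le _ _).trans ?_
    rw [norm_one, norm_mul, Complex.norm_real, Real.norm_of_nonneg hx]
  have h1 : ‖(laguerrePoly m α β n).eval z‖ ≤
      R ^ m * Real.exp (α * R) * ∏ j ∈ range n, (1 + β j * R) := by
    rw [eval_laguerrePoly, norm_mul, norm_mul, norm_pow, norm_pow, norm_prod]
    have h2 : ‖1 + (α : ℂ) * z / n‖ ^ n ≤ Real.exp (α * R) := by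
      have h3 := hone (α / n) (by positivity)
      have h4 : 1 + α / n * R ≤ Real.exp (α / n * R) := by
        linarith [Real.add_one_le_exp (α / n * R)]
      calc ‖1 + (α : ℂ) * z / n‖ ^ n ≤ Real.exp (α / n * R) ^ n := by
            refine pow_le_pow_left₀ (norm_nonneg _) (le_trans (le_of_eq ?_) (h3.trans h4)) n
            push_cast
            congr 2
            ring
        _ = Real.exp (n * (α / n * R)) := (Real.exp_nat_mul _ _).symm
        _ ≤ Real.exp (α * R) := by
          refine Real.exp_le_exp.2 ?_
          -- For n = 0 the convention α / 0 = 0 applies.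
          rcases eq_or_ne n 0 with rfl | hn
          · simp
            positivity
          · have : (n : ℝ) ≠ 0 := by exact_mod_cast hn
            exact le_of_eq (by field_simp)
    have h5 : ∏ j ∈ range n, ‖1 + (β j : ℂ) * z‖ ≤ ∏ j ∈ range n, (1 + β j * R) :=
      prod_le_prod (fun _ _ => norm_nonneg _) fun j _ => hone _ (hβ j)
    have h6 : 0 ≤ ∏ j ∈ range n, ‖1 + (β j : ℂ) * z‖ := prod_nonneg fun _ _ => norm_nonneg _
    gcongr
  refine h1.trans ?_
  have hlim : Tendsto (fun N => ‖(R : ℂ) ^ m * Complex.exp (α * R) *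
      ∏ j ∈ range N, (1 + (β j : ℂ) * R)‖) atTop (𝓝 ‖laguerreFun m α β (R : ℂ)‖) :=
    ((tendsto_prod_one_add_mul hβs _).const_mul _).norm
  refine ge_of_tendsto hlim ((eventually_ge_atTop n).mono fun N hN => ?_)
  have hfac : ∀ j, 1 ≤ 1 + β j * R := fun j => by
    have := mul_nonneg (hβ j) hR
    linarith
  have h7 : ‖(R : ℂ) ^ m * Complex.exp (α * R) * ∏ j ∈ range N, (1 + (β j : ℂ) * R)‖ =
      R ^ m * Real.exp (α * R) * ∏ j ∈ range N, (1 + β j * R) := by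
    have h8 : (R : ℂ) ^ m * Complex.exp (α * R) * ∏ j ∈ range N, (1 + (β j : ℂ) * R) =
        ((R ^ m * Real.exp (α * R) * ∏ j ∈ range N, (1 + β j * R) : ℝ) : ℂ) := by
      push_cast
      rfl
    rw [h8, Complex.norm_real, Real.norm_of_nonneg]
    exact mul_nonneg (by positivity) (prod_nonneg fun j _ => zero_le_one.trans (hfac j))
  rw [h7]
  refine mul_le_mul_of_nonneg_left ?_ (by positivity)
  refine monotone_nat_of_le_succ (f := fun N => ∏ j ∈ range N, (1 + β j * R)) (fun N => ?_) hN
  rw [prod_range_succ]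
  exact le_mul_of_one_le_right (prod_nonneg fun j _ => zero_le_one.trans (hfac j)) (hfac N)

open ComplexOrder in
theorem coeff_laguerrePoly_nonneg (m : ℕ) (hα : 0 ≤ α) (hβ : ∀ j, 0 ≤ β j) (n k : ℕ) :
    0 ≤ (laguerrePoly m α β n).coeff k := by
  have hmul : ∀ p q : ℂ[X], (∀ k, 0 ≤ p.coeff k) → (∀ k, 0 ≤ q.coeff k) →
      ∀ k, 0 ≤ (p * q).coeff k := fun p q hp hq k => by
    rw [coeff_mul]
    exact sum_nonneg fun x _ => mul_nonneg (hp _) (hq _)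
  have hone : ∀ k, 0 ≤ (1 : ℂ[X]).coeff k := fun k => by
    rw [coeff_one]
    split_ifs <;> simp
  have hlin : ∀ x : ℝ, 0 ≤ x → ∀ k, 0 ≤ (1 + C (x : ℂ) * X).coeff k := fun x hx k => by
    rw [coeff_add, coeff_C_mul, coeff_X]
    refine add_nonneg (hone k) (mul_nonneg (by exact_mod_cast hx) ?_)
    split_ifs <;> simp
  refine hmul _ _ (hmul _ _ (fun k => ?_) ?_) ?_ k
  · rw [coeff_X_pow]
    split_ifs <;> simp
  · rw [← Finset.card_range n, ← prod_const]
    exact prod_induction _ (fun p : ℂ[X] => ∀ k, 0 ≤ p.coeff k) hmul hone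
      fun _ _ => hlin _ (by positivity)
  · exact prod_induction _ (fun p : ℂ[X] => ∀ k, 0 ≤ p.coeff k) hmul hone fun j _ => hlin _ (hβ j)

end laguerrePoly

theorem differentiable_laguerreFun (m : ℕ) (α : ℝ) {β : ℕ → ℝ} (hβ : ∀ j, 0 ≤ β j)
    (hβs : Summable β) : Differentiable ℂ (laguerreFun m α β) := by
  have h : Differentiable ℂ fun z : ℂ => ∏' j, (1 + (β j : ℂ) * z) := by
    intro z
    have h1 := Summable.hasProdLocallyUniformlyOn_nat_one_add (R := ℂ)
      (f := fun j (z : ℂ) => (β j : ℂ) * z) (K := Metric.ball 0 (‖z‖ + 1)) Metric.isOpen_ball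
      (hβs.mul_right (‖z‖ + 1)) (Eventually.of_forall fun j w hw => by
        rw [norm_mul, Complex.norm_real, Real.norm_of_nonneg (hβ j)]
        exact mul_le_mul_of_nonneg_left (le_of_lt (by simpa using hw)) (hβ j))
      fun j => by fun_prop
    refine (h1.tendstoLocallyUniformlyOn_finsetRange.differentiableOn
      (Eventually.of_forall fun n => ?_) Metric.isOpen_ball).differentiableAt
      (Metric.isOpen_ball.mem_nhds (by simp))
    fun_prop
  unfold laguerreFun
  fun_prop

/-! ### Preservation of the Laguerre class -/

open ComplexOrder in
-- The value at 0 is a series of nonnegative terms with a positive k-th term. If θ = 0 all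
-- coefficients with j > 0 vanish, so only k = 0 can serve.
theorem expSeq_zero_ne_zero {θ γ : ℝ} (hθ : 0 ≤ θ) (hγ : 0 < γ) {u : ℕ → ℂ} {B r : ℝ}
    (hr : 0 ≤ r) (hrγ : r * γ < 1) (hu : ∀ k, ‖u k‖ ≤ B * r ^ k) (hu0 : ∀ k, 0 ≤ u k) {k : ℕ}
    (hk : u k ≠ 0) (h : 0 < θ ∨ k = 0) : expSeq θ γ u 0 ≠ 0 := by
  have hs := (summable_expSeq hθ hγ.le hr hrγ hu 0).hasSum.mapL Complex.reCLM
  have hnn : ∀ j, 0 ≤ Complex.reCLM (((risingCoeff (θ + (0 : ℕ)) j * γ ^ j : ℝ) : ℂ) * u (0 + j)) :=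
    fun j => by
      have h1 := risingCoeff_nonneg (by positivity : 0 ≤ θ + (0 : ℕ)) j
      have h2 : 0 ≤ (u (0 + j)).re := (Complex.le_def.1 (hu0 _)).1
      rw [Complex.reCLM_apply, Complex.re_ofReal_mul]
      positivity
  have hpos : 0 < Complex.reCLM (((risingCoeff (θ + (0 : ℕ)) k * γ ^ k : ℝ) : ℂ) * u (0 + k)) := by
    have h1 : 0 < risingCoeff (θ + (0 : ℕ)) k := by
      rcases h with h | rfl
      · exact risingCoeff_pos (by positivity) k
      · simp
    have h2 : 0 < (u (0 + k)).re := by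
      rw [zero_add]
      exact (Complex.lt_def.1 (lt_of_le_of_ne (hu0 k) hk.symm)).1
    rw [Complex.reCLM_apply, Complex.re_ofReal_mul]
    positivity
  intro h0
  have h3 := le_hasSum hs k fun j _ => hnn j
  have h4 : Complex.reCLM (expSeq θ γ u 0) = 0 := by rw [h0, map_zero]
  exact absurd (hpos.trans_le (h3.trans_eq h4)) (lt_irrefl _)

open ComplexOrder in
theorem isLaguerre_egf_expSeq_laguerreFun {θ γ : ℝ} (hθ : 0 ≤ θ) (hγ : 0 < γ) {B r : ℝ}
    (hr : 0 < r) (hrγ : r * γ < 1) {m : ℕ} {α : ℝ} {β : ℕ → ℝ} (hα : 0 ≤ α) (hβ : ∀ j, 0 ≤ β j)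
    (hβs : Summable β) (hu : ∀ k, ‖iteratedDeriv k (laguerreFun m α β) 0‖ ≤ B * r ^ k)
    (h : 0 < θ ∨ m = 0) :
    IsLaguerre (egf (expSeq θ γ fun k => iteratedDeriv k (laguerreFun m α β) 0)) := by
  set f := laguerreFun m α β with hfdef
  have hf : Differentiable ℂ f := differentiable_laguerreFun m α hβ hβs
  set u : ℕ → ℂ := fun k => iteratedDeriv k f 0
  set p := laguerrePoly m α β
  have hfu : egf u = f := egf_iteratedDeriv hf
  have hpB : ∀ n z, ‖(p n).eval z‖ ≤ B * Real.exp (r * ‖z‖) := fun n z => by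
    refine (norm_eval_laguerrePoly_le m hα hβ hβs n z).trans ?_
    have h1 := norm_egf_le hu (‖z‖ : ℂ)
    rw [hfu] at h1
    simpa using h1
  -- Room between r and 1/γ, to be spent on the Cauchy estimate.
  obtain ⟨r', hr', hr'γ⟩ : ∃ r', r < r' ∧ r' * γ < 1 := by
    obtain ⟨r', h1, h2⟩ := exists_between ((lt_div_iff₀ hγ).2 hrγ)
    exact ⟨r', h1, (lt_div_iff₀ hγ).1 h2⟩
  have hr'0 : 0 < r' := hr.trans hr'
  have hB0 : 0 ≤ B := (norm_nonneg _).trans ((hu 0).trans_eq (by simp))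
  obtain ⟨K, hK⟩ := exists_succ_mul_pow_le hr hr'
  have hpk : ∀ n k, ‖polySeq (p n) k‖ ≤ B * K * r' ^ k := fun n k => by
    rw [← iteratedDeriv_eval, mul_assoc]
    exact (norm_iteratedDeriv_le_of_exp_bound (p n).differentiable hr (hpB n) k).trans
      (mul_le_mul_of_nonneg_left (hK k) hB0)
  have hplim : ∀ k, Tendsto (fun n => polySeq (p n) k) atTop (𝓝 (u k)) := fun k => by
    simp only [← iteratedDeriv_eval]
    refine tendsto_iteratedDeriv_of_tendsto (M := B * Real.exp (r * 1))
      (fun n => (p n).differentiable) hf (tendsto_eval_laguerrePoly m hβs) (fun n z hz => ?_) k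
    exact hz ▸ hpB n z
  have hu0 : ∀ k, 0 ≤ u k := fun k => ge_of_tendsto' (hplim k) fun n =>
    mul_nonneg (by exact_mod_cast (k !).zero_le) (coeff_laguerrePoly_nonneg m hα hβ n k)
  -- If θ > 0 any nonzero derivative suffices, and one exists because f(1) is an exponential times a
  -- convergent product of positive factors. If m = 0, then f(0) = 1.
  have hne : ∃ k, u k ≠ 0 ∧ (0 < θ ∨ k = 0) := by
    rcases h with h | h
    · by_contra! hall
      have h1 : f 1 = 0 := by
        rw [← hfu, egf]
        refine (tsum_congr fun k => ?_).trans tsum_zero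
        have : u k = 0 := by
          by_contra hk
          exact absurd h (not_lt.2 (hall k hk).1)
        simp [this]
      have h2 : f 1 ≠ 0 := by
        simp only [hfdef, laguerreFun, one_pow, one_mul, mul_one]
        refine mul_ne_zero (Complex.exp_ne_zero _) (tprod_one_add_ne_zero_of_summable
          (fun j => ?_) ?_)
        · have : (0 : ℝ) < 1 + β j := by linarith [hβ j]
          exact_mod_cast this.ne'
        · simpa [abs_of_nonneg (hβ _)] using hβs
      exact h2 h1
    · refine ⟨0, ?_, Or.inr rfl⟩
      simp [u, hfdef, laguerreFun, h]
  obtain ⟨k, hk, hk'⟩ := hne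
  have hF0 := expSeq_zero_ne_zero hθ hγ hr.le hrγ hu hu0 hk hk'
  choose q hq hqp using fun n =>
    (nonposRooted_laguerrePoly m hα hβ n).exists_expSeq (θ := θ) hθ hγ
  have hqlim : ∀ k, Tendsto (fun n => polySeq (q n) k) atTop (𝓝 (expSeq θ γ u k)) := fun k => by
    simp only [← hqp]
    exact tendsto_expSeq hθ hγ.le hr'0.le hr'γ hpk hplim k
  have hqB : ∀ n k, ‖polySeq (q n) k‖ ≤
      B * K * (1 - r' * γ) ^ (-θ) * (r' * (1 - r' * γ)⁻¹) ^ k := fun n k => by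
    rw [← hqp]
    exact norm_expSeq_le hθ hγ.le hr'0.le hr'γ (hpk n) k
  refine isLaguerre_of_tendsto (D := expSeq θ γ u 1) hq (fun z => ?_) ?_ (by simpa using hF0)
  · simp only [eval_eq_egf_polySeq]
    exact tendsto_egf hqB hqlim z
  · refine (hqlim 1).congr fun n => ?_
    rw [eval_eq_egf_polySeq, egf_zero, polySeq_derivative]

theorem IsLaguerre.const_mul {f : ℂ → ℂ} (hf : IsLaguerre f) (s : ℂ) :
    IsLaguerre fun z => s * f z := by
  obtain ⟨C, m, α, β, hα, hβ, hanti, hs, h⟩ := hf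
  exact ⟨s * C, m, α, β, hα, hβ, hanti, hs, fun z => by simp only [h]; ring⟩

theorem IsLaguerre.id_mul {f : ℂ → ℂ} (hf : IsLaguerre f) : IsLaguerre fun z => z * f z := by
  obtain ⟨C, m, α, β, hα, hβ, hanti, hs, h⟩ := hf
  exact ⟨C, m + 1, α, β, hα, hβ, hanti, hs, fun z => by simp only [h]; ring⟩

theorem IsLaguerre.comp_mul {f : ℂ → ℂ} (hf : IsLaguerre f) {s : ℝ} (hs0 : 0 ≤ s) :
    IsLaguerre fun z => f (s * z) := by
  obtain ⟨C, m, α, β, hα, hβ, hanti, hs, h⟩ := hf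
  refine ⟨C * s ^ m, m, α * s, fun j => β j * s, by positivity, fun j => mul_nonneg (hβ j) hs0,
    hanti.mul_const hs0, hs.mul_right s, fun z => ?_⟩
  simp only [h, mul_pow]
  push_cast
  simp only [mul_assoc]

theorem isLaguerre_zero : IsLaguerre fun _ => 0 :=
  ⟨0, 0, 0, 0, le_rfl, fun _ => le_rfl, antitone_const, summable_zero, fun z => by simp⟩

theorem egf_mulSeq {v : ℕ → ℂ} {B r : ℝ} (hv : ∀ k, ‖v k‖ ≤ B * r ^ k) (z : ℂ) :
    egf (mulSeq v) z = z * egf v z := by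
  refine HasSum.tsum_eq ?_
  rw [← hasSum_nat_add_iff' 1]
  simp only [range_one, sum_singleton, mulSeq, zero_div, zero_mul, sub_zero]
  refine ((summable_egf hv z).hasSum.mul_left z).congr_fun fun k => ?_
  have h : (k ! : ℂ) ≠ 0 := by exact_mod_cast k.factorial_ne_zero
  have h' : (k : ℂ) + 1 ≠ 0 := by exact_mod_cast k.succ_ne_zero
  rw [Nat.factorial_succ]
  push_cast
  field_simp
  ring

/-- The exponentiated form of the intertwining relation zD² z = z(2 + zD)D. -/
theorem expSeq_zero_mulSeq (γ : ℝ) (v : ℕ → ℂ) :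
    expSeq 0 γ (mulSeq v) = mulSeq (expSeq 2 γ v) := by
  ext k
  cases k with
  | zero =>
    rw [mulSeq, expSeq]
    refine (tsum_congr fun j => ?_).trans tsum_zero
    cases j with
    | zero => simp [mulSeq]
    | succ j =>
      have h1 := risingCoeff_succ_left 0 j
      rw [zero_mul, mul_eq_zero] at h1
      have h2 : risingCoeff 0 (j + 1) = 0 := h1.resolve_right (by positivity)
      simp [h2]
  | succ k =>
    rw [mulSeq, expSeq, expSeq, ← tsum_mul_left]
    refine tsum_congr fun j => ?_
    have h1 := (risingCoeff_succ (k + 1) j).symm.trans (risingCoeff_succ_left (k + 1) j)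
    have h2 := congrArg (fun x : ℝ => (x : ℂ)) h1
    push_cast at h2
    rw [show k + 1 + j = (k + j) + 1 by ring, mulSeq]
    push_cast
    rw [show (0 : ℝ) + (k + 1) = k + 1 by ring, show (2 : ℝ) + k = k + 1 + 1 by ring]
    linear_combination (γ ^ j * v (k + j) : ℂ) * h2

theorem expSeq_zero_right (θ : ℝ) (u : ℕ → ℂ) : expSeq θ 0 u = u := by
  ext k
  rw [expSeq, tsum_eq_single 0 fun j hj => by simp [hj]]
  simp

/-- `exp (γ (θ + zD) D)` preserves the Laguerre entire functions. -/
theorem IsLaguerre.egf_expSeq {θ γ : ℝ} (hθ : 0 ≤ θ) (hγ : 0 ≤ γ) {B r : ℝ} (hr : 0 < r)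
    (hrγ : r * γ < 1) {f : ℂ → ℂ} (hfd : Differentiable ℂ f)
    (hu : ∀ k, ‖iteratedDeriv k f 0‖ ≤ B * r ^ k) (hf : IsLaguerre f) :
    IsLaguerre (egf (expSeq θ γ fun k => iteratedDeriv k f 0)) := by
  rcases hγ.eq_or_lt with rfl | hγ
  · rwa [expSeq_zero_right, egf_iteratedDeriv hfd]
  obtain ⟨c, m, α, β, hα, hβ, hanti, hs, h⟩ := hf
  have hfl : f = fun z => c * laguerreFun m α β z := funext fun z => by
    rw [h, laguerreFun]
    ring
  have hseq : (fun k => iteratedDeriv k f 0) =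
      fun k => c * iteratedDeriv k (laguerreFun m α β) 0 := funext fun k => by
    rw [hfl, iteratedDeriv_const_mul_field]
  have hegf : egf (expSeq θ γ fun k => iteratedDeriv k f 0) = fun z =>
      c * egf (expSeq θ γ fun k => iteratedDeriv k (laguerreFun m α β) 0) z := by
    ext z
    rw [hseq, egf, egf, ← tsum_mul_left]
    refine tsum_congr fun k => ?_
    rw [expSeq_const_mul]
    ring
  rw [hegf]
  rcases eq_or_ne c 0 with rfl | hc
  · simpa using isLaguerre_zero
  refine IsLaguerre.const_mul ?_ c
  have hu' : ∀ k, ‖iteratedDeriv k (laguerreFun m α β) 0‖ ≤ B / ‖c‖ * r ^ k := fun k => by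
    have h1 := hu k
    rw [congrFun hseq k, norm_mul] at h1
    rw [div_mul_eq_mul_div, le_div_iff₀ (norm_pos_iff.2 hc), mul_comm]
    exact h1
  by_cases hcase : 0 < θ ∨ m = 0
  · exact isLaguerre_egf_expSeq_laguerreFun hθ hγ hr hrγ hα hβ hs hu' hcase
  -- In the remaining case θ = 0 and m ≥ 1 the image vanishes at 0, so the limit lemma does not
  -- apply. One factor z is pulled through the operator, which turns θ = 0 into θ = 2 > 0.
  push Not at hcase
  obtain rfl : θ = 0 := le_antisymm hcase.1 hθ
  obtain ⟨m, rfl⟩ := Nat.exists_eq_succ_of_ne_zero hcase.2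
  have hd := differentiable_laguerreFun m α hβ hs
  have hmul : laguerreFun (m + 1) α β = fun z => z * laguerreFun m α β z := funext fun z => by
    simp only [laguerreFun]
    ring
  have hsucc : (fun k => iteratedDeriv k (laguerreFun (m + 1) α β) 0) =
      mulSeq fun k => iteratedDeriv k (laguerreFun m α β) 0 := by
    ext k
    cases k with
    | zero => simp [mulSeq, hmul]
    | succ k => rw [hmul, iteratedDeriv_succ_id_mul hd, mulSeq]
  have hv : ∀ k, ‖iteratedDeriv k (laguerreFun m α β) 0‖ ≤ B / ‖c‖ * r * r ^ k := fun k => by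
    refine le_trans ?_ ((hu' (k + 1)).trans_eq (by ring))
    rw [congrFun hsucc (k + 1), mulSeq, norm_mul]
    refine le_mul_of_one_le_left (norm_nonneg _) ?_
    have : ((k : ℂ) + 1) = ((k + 1 : ℕ) : ℂ) := by push_cast; rfl
    rw [this, Complex.norm_natCast]
    exact_mod_cast Nat.succ_pos k
  rw [hsucc, expSeq_zero_mulSeq,
    funext (egf_mulSeq (norm_expSeq_le zero_le_two hγ.le hr.le hrγ hv))]
  exact (isLaguerre_egf_expSeq_laguerreFun zero_le_two hγ hr hrγ hα hβ hs hv
    (Or.inl two_pos)).id_mul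

/-- Scaling the k-th derivative by e^{aωk} is a dilation of the variable, and dilations preserve 𝓛⁺.
-/
theorem egf_expDeltaSeq (a θ ω : ℝ) (u : ℕ → ℂ) :
    egf (expDeltaSeq a θ ω u) = fun z => egf (expSeq θ (gam a ω) u) (Real.exp (a * ω) * z) := by
  ext z
  rw [egf, egf]
  refine tsum_congr fun k => ?_
  rw [expDeltaSeq, mul_pow]
  ring

theorem mapsTo_expDelta {θ ω a b : ℝ} (hθ : 0 ≤ θ) (ha : 0 ≤ a) (hb : 0 ≤ b)
    (hab : b * gam a ω < 1) :
    Set.MapsTo (expDelta hθ ha hb hab) (Lplus b) (Lplus (cOf a ω b)) := by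
  intro f hf
  obtain ⟨r, hbr, hrγ, -⟩ := exists_cOf_lt hab (lt_add_one (cOf a ω b))
  have hr : 0 < r := hb.trans_lt hbr
  have hfr := f.2 ⟨r, hr, hbr⟩
  change IsLaguerre (expDelta hθ ha hb hab f).1
  rw [expDelta_apply, egf_expDeltaSeq]
  exact (IsLaguerre.egf_expSeq hθ (gam_nonneg ha ω) hr hrγ hfr.1
    (norm_iteratedDeriv_le_bNorm hr hfr) hf).comp_mul (Real.exp_nonneg _)

/-! ### Density of polynomials, uniqueness, and the theorem -/

theorem t2Space_A (c : ℝ) : T2Space (A c) := by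
  have hw := withSeminorms_normFamily c
  have : IsTopologicalAddGroup (A c) := hw.topologicalAddGroup
  have : T1Space (A c) := hw.T1_of_separating fun f hf => by
    obtain ⟨r⟩ : Nonempty (Idx c) := inferInstance
    refine ⟨r, fun h0 => hf (A.ext fun k => ?_)⟩
    have h1 := norm_iteratedDeriv_le_bNorm r.2.1 (f.2 r) k
    rw [← normFamily_apply, h0, zero_mul] at h1
    rw [norm_le_zero_iff.1 h1]
    exact (iteratedDeriv_fun_const_zero).symm
  infer_instance

/-- A polynomial as an element of `𝓐_b`. -/
def polyA (b : ℝ) (p : ℂ[X]) : A b := ⟨fun z => p.eval z, fun r => by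
  obtain ⟨B, hB⟩ := exists_polySeq_bound p r.2.1
  refine memB_of_bound r.2.1 p.differentiable (B := B) fun k => ?_
  rw [iteratedDeriv_eval]
  exact hB k⟩

/-- The Taylor polynomials of `f` at `0`. -/
def taylorPoly (f : ℂ → ℂ) (N : ℕ) : ℂ[X] :=
  ∑ k ∈ range N, C (iteratedDeriv k f 0 / (k ! : ℂ)) * X ^ k

theorem polySeq_taylorPoly (f : ℂ → ℂ) (N k : ℕ) :
    polySeq (taylorPoly f N) k = if k < N then iteratedDeriv k f 0 else 0 := by
  have h : (k ! : ℂ) ≠ 0 := by exact_mod_cast k.factorial_ne_zero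
  simp only [polySeq, taylorPoly, finsetSum_coeff, coeff_C_mul, coeff_X_pow, mul_ite, mul_one,
    mul_zero, sum_ite_eq, mem_range]
  split_ifs
  · field_simp
  · rfl

theorem tendsto_polyA_taylorPoly {b : ℝ} (hb : 0 ≤ b) (f : A b) :
    Tendsto (fun N => polyA b (taylorPoly f.1 N)) atTop (𝓝 f) := by
  rw [(withSeminorms_normFamily b).tendsto_nhds]
  intro r ε hε
  -- In the norm of index r, the Taylor tail is O((r'/r)^N), as f also has finite norm of index r' <
  -- r.
  obtain ⟨r', hbr', hr'r⟩ := exists_between r.2.2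
  have hr' : 0 < r' := hb.trans_lt hbr'
  have hf := f.2 ⟨r', hr', hbr'⟩
  have hK : 0 ≤ bNorm r' f.1 := Real.iSup_nonneg fun k => by positivity
  have hq : r' / r < 1 := (div_lt_one r.2.1).2 hr'r
  have hr0 := r.2.1
  have hlim : Tendsto (fun N : ℕ => bNorm r' f.1 * (r' / r) ^ N) atTop (𝓝 0) := by
    simpa using (tendsto_pow_atTop_nhds_zero_of_lt_one (by positivity) hq).const_mul (bNorm r' f.1)
  refine (hlim.eventually_lt_const hε).mono fun N hN => lt_of_le_of_lt ?_ hN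
  refine bNorm_le_of_bound r.2.1 fun k => ?_
  have h1 : iteratedDeriv k (polyA b (taylorPoly f.1 N) - f).1 0 =
      polySeq (taylorPoly f.1 N) k - iteratedDeriv k f.1 0 := by
    rw [← iteratedDeriv_eval]
    exact iteratedDeriv_sub (taylorPoly f.1 N).differentiable.contDiff.contDiffAt
      hf.1.contDiff.contDiffAt
  rw [h1, polySeq_taylorPoly]
  split_ifs with hk
  · rw [sub_self, norm_zero]
    positivity
  · rw [zero_sub, norm_neg]
    refine (norm_iteratedDeriv_le_bNorm hr' hf k).trans ?_
    have h2 : r' ^ k = (r' / r) ^ k * (r : ℝ) ^ k := by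
      rw [div_pow, div_mul_cancel₀ _ (by positivity)]
    rw [h2, ← mul_assoc]
    have h3 : (r' / r) ^ k ≤ (r' / r) ^ N :=
      pow_le_pow_of_le_one (by positivity) hq.le (not_lt.1 hk)
    gcongr

/-- Both operators agree on the Taylor polynomials of f, which converge to f, and limits in 𝓐_c are
unique. -/
theorem IsExpDelta.eq {a θ ω b c : ℝ} (hb : 0 ≤ b) {E E' : A b →L[ℂ] A c}
    (hE : IsExpDelta a θ ω E) (hE' : IsExpDelta a θ ω E') : E' = E := by
  have := t2Space_A c
  ext1 f
  have h := tendsto_polyA_taylorPoly hb f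
  refine tendsto_nhds_unique ((E'.continuous.tendsto f).comp h) ?_
  refine ((E.continuous.tendsto f).comp h).congr fun N => Subtype.ext (funext fun z => ?_)
  exact (hE (polyA b (taylorPoly f.1 N)) _ (fun _ => rfl) z).unique
    (hE' (polyA b (taylorPoly f.1 N)) _ (fun _ => rfl) z)

/-- For a polynomial the rate r may be chosen arbitrarily small, so the condition involving |ω|
costs nothing. -/
theorem isExpDelta_expDelta {θ ω a b : ℝ} (hθ : 0 ≤ θ) (ha : 0 ≤ a) (hb : 0 ≤ b)
    (hab : b * gam a ω < 1) : IsExpDelta a θ ω (expDelta hθ ha hb hab) := by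
  intro f p hfp
  have hγ := gam_nonneg ha |ω|
  obtain ⟨r, hr, hrγ⟩ : ∃ r : ℝ, 0 < r ∧ r * gam a |ω| < 1 :=
    ⟨(gam a |ω| + 1)⁻¹, by positivity, by rw [inv_mul_lt_iff₀ (by positivity)]; linarith⟩
  obtain ⟨B, hB⟩ := exists_polySeq_bound p hr
  have hf : f.1 = fun z => p.eval z := funext hfp
  refine hasSeries_egf_expDeltaSeq (B := B) hθ ha ?_ hr.le hrγ fun k => ?_
  · rw [hf]
    exact p.differentiable
  · rw [hf, iteratedDeriv_eval]
    exact hB k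

theorem hasSeries_expDelta {θ ω a b : ℝ} (hθ : 0 ≤ θ) (ha : 0 ≤ a) (hb : 0 ≤ b)
    (hab : b * gam a ω < 1) (hab' : b * gam a |ω| < 1) (f : A b) :
    HasSeries (fun z => Complex.exp (a * z)) θ ω f (expDelta hθ ha hb hab f) := by
  obtain ⟨r, hbr, hrγ, -⟩ := exists_cOf_lt hab' (lt_add_one (cOf a |ω| b))
  have hr : 0 < r := hb.trans_lt hbr
  have hfr := f.2 ⟨r, hr, hbr⟩
  exact hasSeries_egf_expDeltaSeq hθ ha hfr.1 hr.le hrγ (norm_iteratedDeriv_le_bNorm hr hfr)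

end LaguerreOp

end

theorem theorem2p30 (θ ω a b : ℝ) (hθ : 0 ≤ θ) (ha : 0 ≤ a) (hb : 0 ≤ b)
    (hab : b * LaguerreOp.gam a ω < 1) :
    ∃ E : LaguerreOp.A b →L[ℂ] LaguerreOp.A (LaguerreOp.cOf a ω b),
      LaguerreOp.IsExpDelta a θ ω E ∧
      (∀ E' : LaguerreOp.A b →L[ℂ] LaguerreOp.A (LaguerreOp.cOf a ω b),
        LaguerreOp.IsExpDelta a θ ω E' → E' = E) ∧
      (b * LaguerreOp.gam a |ω| < 1 → ∀ f : LaguerreOp.A b,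
        LaguerreOp.HasSeries (fun z => Complex.exp (a * z)) θ ω f (E f)) ∧
      ∃ hE : Set.MapsTo E (LaguerreOp.Lplus b) (LaguerreOp.Lplus (LaguerreOp.cOf a ω b)),
        Continuous (hE.restrict E (LaguerreOp.Lplus b)
          (LaguerreOp.Lplus (LaguerreOp.cOf a ω b))) := by
  have hE := LaguerreOp.isExpDelta_expDelta hθ ha hb hab
  exact ⟨LaguerreOp.expDelta hθ ha hb hab, hE, fun E' hE' => hE.eq hb hE',
    LaguerreOp.hasSeries_expDelta hθ ha hb hab, LaguerreOp.mapsTo_expDelta hθ ha hb hab,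
    (LaguerreOp.expDelta hθ ha hb hab).continuous.restrict _⟩
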